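/- Let $H$ be a separable complex Hilbert space, let $A_1=A_1^*\le 0$ and $A_3=A_3^*\ge 0$ be (possibly unbounded) self-adjoint operators in $H$, let $-\infty<a_1<a_3<\infty$, and assume that $0$ is an eigenvalue of both $(-A_1)^{1/2}$ and $A_3^{1/2}$. On an open half-line $I$ the minimal operator generated by $\frac{d}{dt}+A$ in $L^2(H,I)$ is the closure of $\frac{d}{dt}+A$ on the finite sums of functions $\varphi(t)g$ with $\varphi\in C_0^\infty(I)$, $g\in D(A)$; the maximal operator is the adjoint of $-\frac{d}{dt}+A$ on the same functions, i.e. it acts as $u\mapsto u'+Au$ (in the weak sense) on all $u\in L^2(H,I)$ with $u'+Au\in L^2(H,I)$. Let $L_0(1,0,1)=L_{10}\oplus L_{30}$ and $L(1,0,1)=L_1\oplus L_3$ be the orthogonal sums of the minimal, respectively maximal, operators generated by $\frac{d}{dt}+A_1$ on $(-\infty,a_1)$ and $\frac{d}{dt}+A_3$ on $(a_3,\infty)$, in the Hilbert space $L^2(H,(-\infty,a_1))\oplus L^2(H,(a_3,\infty))$. A densely defined closed operator $N$ is called normal if $D(N)=D(N^*)$ and $\|Nx\|=\|N^*x\|$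 for all $x\in D(N)$. For a unitary operator $W_1$ in $H$ let $L_{W_1}$ be the restriction of $L(1,0,1)$ to those $(u_1,u_3)$ in its domain which have boundary values in $H$ with $$u_3(a_3)=W_1u_1(a_1),\qquad u_1(a_1)\in\ker(-A_1)^{1/2},\qquad u_3(a_3)\in\ker A_3^{1/2}$$ (boundary values being understood through Green's formula against the functions $\varphi(t)g$ with $\varphi\in C_0^\infty(\mathbb R)$, $g\in D(A_1)$, respectively $g\in D(A_3)$). Then every normal extension $N$ of $L_0(1,0,1)$ in this space has empty point spectrum, $\sigma_p(N)=\emptyset$. Moreover, for every unitary operator $W_1$ in $H$, the operator $L_{W_1}$ given by the boundary conditions above has empty point spectrum, $\sigma_p(L_{W_1})=\emptyset$. -/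

import Mathlib

open MeasureTheory Set
open scoped ContDiff InnerProductSpace

noncomputable section

namespace NormalExtension

/-! ### Unbounded operators in a complex Hilbert space -/

section Operators

variable {E F : Type*}
variable [NormedAddCommGroup E] [InnerProductSpace ℂ E]
variable [NormedAddCommGroup F] [InnerProductSpace ℂ F]

/-- `T ≥ 0`, that is `(T x, x) ≥ 0` for all `x` in the domain of `T`. Since self-adjoint operators
have real quadratic forms, only the real part is mentioned. -/
def IsNonneg (T : E →ₗ.[ℂ] E) : Prop :=
  ∀ x : T.domain, 0 ≤ (inner ℂ (x : E) (T x)).re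

/-- `T ≤ 0`. -/
def IsNonpos (T : E →ₗ.[ℂ] E) : Prop :=
  ∀ x : T.domain, (inner ℂ (x : E) (T x)).re ≤ 0

/-- The kernel of an unbounded operator, as a subspace of the ambient Hilbert space. -/
def kernel (T : E →ₗ.[ℂ] E) : Submodule ℂ E :=
  (LinearMap.ker T.toFun).map T.domain.subtype

/-- The point spectrum: the set of eigenvalues. -/
def pointSpectrum (T : E →ₗ.[ℂ] E) : Set ℂ :=
  {lam | ∃ x : T.domain, (x : E) ≠ 0 ∧ T x = lam • (x : E)}

/-- A densely defined closed operator `T` is normal if `D(T) = D(T*)` and `‖T x‖ = ‖T* x‖` for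
all `x` in this common domain. -/
structure IsNormal [CompleteSpace E] (T : E →ₗ.[ℂ] E) : Prop where
  dense_domain : Dense (T.domain : Set E)
  isClosed : T.IsClosed
  domain_adjoint : T.adjoint.domain = T.domain
  norm_adjoint : ∀ (x : T.domain) (y : T.adjoint.domain), (x : E) = y → ‖T x‖ = ‖T.adjoint y‖

/-- `N` is a normal extension of `T` (within the same Hilbert space). -/
def IsNormalExtension [CompleteSpace E] (T N : E →ₗ.[ℂ] E) : Prop :=
  T ≤ N ∧ IsNormal N

/-- `S` is the positive square root of `T`: it is self-adjoint, `S ≥ 0` and `S ^ 2 = T`, including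
the equality of domains. -/
structure IsPosSqrt [CompleteSpace E] (S T : E →ₗ.[ℂ] E) : Prop where
  isSelfAdjoint : IsSelfAdjoint S
  nonneg : IsNonneg S
  sq : ∀ x y : E, (x, y) ∈ T.graph ↔ ∃ z : E, (x, z) ∈ S.graph ∧ (z, y) ∈ S.graph

/-- The orthogonal sum `S ⊕ T` in the Hilbert space `E ⊕ F`. -/
def dirSum (S : E →ₗ.[ℂ] E) (T : F →ₗ.[ℂ] F) : WithLp 2 (E × F) →ₗ.[ℂ] WithLp 2 (E × F) where
  domain := (S.domain.prod T.domain).comap (WithLp.linearEquiv 2 ℂ (E × F)).toLinearMap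
  toFun :=
    { toFun := fun u => WithLp.toLp 2
        (S ⟨(u : WithLp 2 (E × F)).fst, u.2.1⟩, T ⟨(u : WithLp 2 (E × F)).snd, u.2.2⟩)
      map_add' := fun u v => by
        have h1 := S.map_add ⟨(u : WithLp 2 (E × F)).fst, u.2.1⟩
          ⟨(v : WithLp 2 (E × F)).fst, v.2.1⟩
        have h2 := T.map_add ⟨(u : WithLp 2 (E × F)).snd, u.2.2⟩
          ⟨(v : WithLp 2 (E × F)).snd, v.2.2⟩
        rw [← WithLp.toLp_add, Prod.mk_add_mk, ← h1, ← h2]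
        rfl
      map_smul' := fun c u => by
        have h1 := S.map_smul c ⟨(u : WithLp 2 (E × F)).fst, u.2.1⟩
        have h2 := T.map_smul c ⟨(u : WithLp 2 (E × F)).snd, u.2.2⟩
        rw [RingHom.id_apply, ← WithLp.toLp_smul, Prod.smul_mk, ← h1, ← h2]
        rfl }

/-! ### Existence of the positive square root -/

/-- Every self-adjoint operator `T ≥ 0` has a bounded resolvent `(1 + T)⁻¹`. -/
theorem exists_resolvent [CompleteSpace E] {T : E →ₗ.[ℂ] E} (hT : IsSelfAdjoint T) (hpos : IsNonneg T) :
    ∃ B : E →L[ℂ] E, ∀ y x : E, B y = x ↔ (x, y - x) ∈ T.graph := by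
  have hdense := hT.dense_domain
  have hT' : T.adjoint = T := hT
  -- the lower bound
  have hlow : ∀ x : T.domain, ‖(x : E)‖ ≤ ‖(x : E) + T x‖ := by
    intro x
    rcases eq_or_ne (x : E) 0 with h0 | h0
    · simp [h0]
    have h1 : ‖(x : E)‖ ^ 2 ≤ (inner ℂ (x : E) ((x : E) + T x)).re := by
      have h2 : (inner ℂ (x : E) (x : E)).re = ‖(x : E)‖ ^ 2 := inner_self_eq_norm_sq (𝕜 := ℂ) _
      rw [inner_add_right, Complex.add_re, h2]
      linarith [hpos x]
    have h2 : (inner ℂ (x : E) ((x : E) + T x)).re ≤ ‖(x : E)‖ * ‖(x : E) + T x‖ :=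
      re_inner_le_norm (𝕜 := ℂ) _ _
    have h3 : 0 < ‖(x : E)‖ := norm_pos_iff.mpr h0
    nlinarith
  let f : T.domain →ₗ[ℂ] E := T.domain.subtype + T.toFun
  have hf : ∀ x : T.domain, f x = (x : E) + T x := fun x => rfl
  have hinj : Function.Injective f := by
    rw [injective_iff_map_eq_zero]
    intro x hx
    have := hlow x
    rw [← hf, hx, norm_zero] at this
    exact Subtype.ext (norm_le_zero_iff.mp this)
  have hclosed : IsClosed (LinearMap.range f : Set E) := by
    rw [← isSeqClosed_iff_isClosed]
    intro y l hy hl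
    choose x hx using hy
    have hc : CauchySeq (fun n => (x n : E)) := by
      have hcy := hl.cauchySeq
      rw [Metric.cauchySeq_iff'] at hcy ⊢
      intro ε hε
      obtain ⟨N, hN⟩ := hcy ε hε
      refine ⟨N, fun n hn => lt_of_le_of_lt ?_ (hN n hn)⟩
      rw [dist_eq_norm, dist_eq_norm, ← hx n, ← hx N, ← map_sub, hf]
      exact hlow (x n - x N)
    obtain ⟨x₀, hx₀⟩ := cauchySeq_tendsto_of_complete hc
    have hcl : IsClosed (T.graph : Set (E × E)) := hT.isClosed
    have hmem : (x₀, l - x₀) ∈ T.graph := by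
      refine hcl.mem_of_tendsto (hx₀.prodMk_nhds (hl.sub hx₀)) (Filter.Eventually.of_forall ?_)
      intro n
      have : y n - (x n : E) = T (x n) := by rw [← hx n, hf]; abel
      rw [this]
      exact T.mem_graph (x n)
    rw [LinearPMap.mem_graph_iff] at hmem
    obtain ⟨z, hz1, hz2⟩ := hmem
    refine ⟨z, ?_⟩
    rw [hf, hz2]
    change (z : E) = x₀ at hz1
    rw [hz1]
    simp
  have hsurj : LinearMap.range f = ⊤ := by
    have hcs : IsComplete (LinearMap.range f : Set E) := hclosed.isComplete
    have : CompleteSpace (LinearMap.range f) := hcs.completeSpace_coe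
    rw [← Submodule.orthogonal_eq_bot_iff, Submodule.eq_bot_iff]
    intro y hy
    have hy' : ∀ x : T.domain, inner ℂ (-y) (x : E) = inner ℂ y (T x) := by
      intro x
      have := (Submodule.mem_orthogonal' _ _).mp hy (f x) ⟨x, rfl⟩
      rw [hf, inner_add_right] at this
      rw [inner_neg_left]
      linear_combination -this
    have hyd : y ∈ T.adjoint.domain := LinearPMap.mem_adjoint_domain_of_exists y ⟨-y, hy'⟩
    have hval : T.adjoint ⟨y, hyd⟩ = -y := LinearPMap.adjoint_apply_eq hdense ⟨y, hyd⟩ hy'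
    have hg : (y, -y) ∈ T.graph := by
      rw [← hT', ← hval]
      exact T.adjoint.mem_graph ⟨y, hyd⟩
    rw [LinearPMap.mem_graph_iff] at hg
    obtain ⟨z, hz1, hz2⟩ := hg
    change (z : E) = y at hz1
    have := hpos z
    rw [hz2, hz1, inner_neg_right, Complex.neg_re] at this
    have h2 : (inner ℂ y y).re = ‖y‖ ^ 2 := inner_self_eq_norm_sq (𝕜 := ℂ) _
    have h3 : ‖y‖ = 0 := by nlinarith [norm_nonneg y]
    exact norm_eq_zero.mp h3
  let e : T.domain ≃ₗ[ℂ] E := LinearEquiv.ofBijective f ⟨hinj, LinearMap.range_eq_top.mp hsurj⟩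
  have he : ∀ x, e x = (x : E) + T x := fun x => rfl
  refine ⟨LinearMap.mkContinuous (T.domain.subtype ∘ₗ e.symm.toLinearMap) 1 ?_, ?_⟩
  · intro y
    have := hlow (e.symm y)
    rw [← he, LinearEquiv.apply_symm_apply] at this
    simpa using this
  · intro y x
    change ((e.symm y : T.domain) : E) = x ↔ _
    rw [LinearPMap.mem_graph_iff]
    constructor
    · rintro rfl
      refine ⟨e.symm y, rfl, ?_⟩
      have := he (e.symm y)
      rw [LinearEquiv.apply_symm_apply] at this
      change T (e.symm y) = y - (e.symm y : E)
      rw [eq_sub_iff_add_eq, add_comm]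
      exact this.symm
    · rintro ⟨z, hz1, hz2⟩
      change (z : E) = x at hz1
      change T z = y - x at hz2
      have : e z = y := by rw [he, hz2, hz1]; abel
      rw [← this, LinearEquiv.symm_apply_apply, hz1]

/-- Every self-adjoint operator `T ≥ 0` has a positive square root. -/
theorem exists_isPosSqrt [CompleteSpace E] {T : E →ₗ.[ℂ] E} (hT : IsSelfAdjoint T) (hpos : IsNonneg T) :
    ∃ S : E →ₗ.[ℂ] E, IsPosSqrt S T := by
  obtain ⟨B, hB⟩ := exists_resolvent hT hpos
  have hdense := hT.dense_domain
  have hT' : T.adjoint = T := hT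
  have hsymm : ∀ x y : T.domain, inner ℂ (T x) (y : E) = inner ℂ (x : E) (T y) := by
    intro x y
    have h := LinearPMap.adjoint_isFormalAdjoint hdense
    rw [hT'] at h
    exact h x y
  have hBy : ∀ y : E, ∃ x : T.domain, B y = x ∧ y = x + T x := by
    intro y
    have := (hB y (B y)).mp rfl
    rw [LinearPMap.mem_graph_iff] at this
    obtain ⟨z, hz1, hz2⟩ := this
    change (z : E) = B y at hz1
    change T z = y - B y at hz2
    refine ⟨z, hz1.symm, ?_⟩
    rw [hz2, hz1]; abel
  have hBinj : ∀ y, B y = 0 → y = 0 := by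
    intro y hy
    obtain ⟨x, h1, h2⟩ := hBy y
    have hx : x = 0 := Subtype.ext (h1.symm.trans hy)
    rw [h2, hx]; simp
  have hBsymm : (B : E →ₗ[ℂ] E).IsSymmetric := by
    intro y y'
    obtain ⟨x, h1, h2⟩ := hBy y
    obtain ⟨x', h1', h2'⟩ := hBy y'
    change inner ℂ (B y) y' = inner ℂ y (B y')
    rw [h1, h1', h2, h2', inner_add_left, inner_add_right, hsymm]
  have hB0 : (0 : E →L[ℂ] E) ≤ B := by
    rw [ContinuousLinearMap.nonneg_iff_isPositive]
    refine ⟨hBsymm, fun y => ?_⟩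
    obtain ⟨x, h1, h2⟩ := hBy y
    rw [ContinuousLinearMap.reApplyInnerSelf_apply, h1]
    nth_rw 1 [h2]
    rw [inner_add_right, map_add]
    have h3 : RCLike.re (inner ℂ (x : E) (x : E)) = ‖(x : E)‖ ^ 2 := inner_self_eq_norm_sq _
    have h4 := hpos x
    rw [h3]
    exact add_nonneg (sq_nonneg _) h4
  have hB1 : B ≤ 1 := by
    rw [ContinuousLinearMap.le_def]
    refine ⟨?_, fun y => ?_⟩
    · intro y y'
      have := hBsymm y y'
      change inner ℂ (B y) y' = inner ℂ y (B y') at this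
      change inner ℂ (y - B y) y' = inner ℂ y (y' - B y')
      rw [inner_sub_left, inner_sub_right, this]
    · obtain ⟨x, h1, h2⟩ := hBy y
      rw [ContinuousLinearMap.reApplyInnerSelf_apply]
      change 0 ≤ RCLike.re (inner ℂ (y - B y) y)
      have h5 : y - B y = T x := by rw [h1, h2]; abel
      rw [h5]
      nth_rw 1 [h2]
      rw [inner_add_right, map_add]
      have h3 : RCLike.re (inner ℂ (T x) (T x)) = ‖T x‖ ^ 2 := inner_self_eq_norm_sq _
      have h4 := hpos x
      rw [h3, hsymm]
      exact add_nonneg h4 (sq_nonneg _)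
  have hBsa : IsSelfAdjoint B := IsSelfAdjoint.of_nonneg hB0
  have hspec : ∀ r ∈ spectrum ℝ B, 0 ≤ r ∧ r ≤ 1 := by
    intro r hr
    refine ⟨spectrum_nonneg_of_nonneg hB0 hr, ?_⟩
    have h1 : B ≤ algebraMap ℝ (E →L[ℂ] E) 1 := by rwa [map_one]
    exact (le_algebraMap_iff_spectrum_le (a := B) (r := 1) hBsa).mp h1 r hr
  let C : E →L[ℂ] E := cfc (fun r : ℝ => Real.sqrt r) B
  let D : E →L[ℂ] E := cfc (fun r : ℝ => Real.sqrt (1 - r)) B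
  have hCC : C * C = B := by
    change cfc _ B * cfc _ B = B
    rw [← cfc_mul (fun r : ℝ => Real.sqrt r) (fun r : ℝ => Real.sqrt r) B (by fun_prop)
      (by fun_prop)]
    conv_rhs => rw [← cfc_id' ℝ B]
    exact cfc_congr fun r hr => Real.mul_self_sqrt (hspec r hr).1
  have hDD : D * D = 1 - B := by
    change cfc _ B * cfc _ B = 1 - B
    rw [← cfc_mul (fun r : ℝ => Real.sqrt (1 - r)) (fun r : ℝ => Real.sqrt (1 - r)) B
      (by fun_prop) (by fun_prop)]
    have h1 : (1 : E →L[ℂ] E) - B = cfc (fun r : ℝ => 1 - r) B := by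
      rw [cfc_sub (fun _ : ℝ => 1) (fun r : ℝ => r) B (by fun_prop) (by fun_prop), cfc_id' ℝ B,
        cfc_const_one ℝ B]
    rw [h1]
    exact cfc_congr fun r hr => Real.mul_self_sqrt (by linarith [(hspec r hr).2])
  have hCD : C * D = D * C := cfc_commute_cfc _ _ B
  have hCsa : IsSelfAdjoint C := cfc_predicate _ B
  have hDsa : IsSelfAdjoint D := cfc_predicate _ B
  have hCD0 : (0 : E →L[ℂ] E) ≤ C * D := by
    change 0 ≤ cfc _ B * cfc _ B
    rw [← cfc_mul (fun r : ℝ => Real.sqrt r) (fun r : ℝ => Real.sqrt (1 - r)) B (by fun_prop)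
      (by fun_prop)]
    exact cfc_nonneg fun r _ => by positivity
  have hCs : ∀ x y : E, inner ℂ (C x) y = inner ℂ x (C y) :=
    fun x y => (ContinuousLinearMap.isSelfAdjoint_iff_isSymmetric.mp hCsa) x y
  have hDs : ∀ x y : E, inner ℂ (D x) y = inner ℂ x (D y) :=
    fun x y => (ContinuousLinearMap.isSelfAdjoint_iff_isSymmetric.mp hDsa) x y
  have hCC' : ∀ y, C (C y) = B y := fun y => congrArg (fun L : E →L[ℂ] E => L y) hCC
  have hDD' : ∀ y, D (D y) = y - B y := fun y => congrArg (fun L : E →L[ℂ] E => L y) hDD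
  have hCD' : ∀ y, C (D y) = D (C y) := fun y => congrArg (fun L : E →L[ℂ] E => L y) hCD
  have hCinj : ∀ y, C y = 0 → y = 0 := fun y hy => hBinj y (by rw [← hCC', hy, map_zero])
  let G : Submodule ℂ (E × E) := LinearMap.range ((C : E →ₗ[ℂ] E).prod (D : E →ₗ[ℂ] E))
  have hG : ∀ p : E × E, p ∈ G ↔ ∃ y, C y = p.1 ∧ D y = p.2 := by
    intro p
    constructor
    · rintro ⟨y, rfl⟩
      exact ⟨y, rfl, rfl⟩
    · rintro ⟨y, h1, h2⟩
      exact ⟨y, Prod.ext h1 h2⟩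
  have hGsv : ∀ p ∈ G, p.1 = 0 → p.2 = 0 := by
    intro p hp h0
    obtain ⟨y, h1, h2⟩ := (hG p).mp hp
    rw [← h2, hCinj y (h1.trans h0), map_zero]
  let S : E →ₗ.[ℂ] E := G.toLinearPMap
  have hS : S.graph = G := G.toLinearPMap_graph_eq hGsv
  have hSdom : ∀ x : E, x ∈ S.domain ↔ ∃ y, C y = x := by
    intro x
    rw [LinearPMap.mem_domain_iff, hS]
    constructor
    · rintro ⟨z, hz⟩
      obtain ⟨y, h1, -⟩ := (hG _).mp hz
      exact ⟨y, h1⟩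
    · rintro ⟨y, h1⟩
      exact ⟨D y, (hG _).mpr ⟨y, h1, rfl⟩⟩
  have hSval : ∀ x : S.domain, ∃ y, C y = x ∧ D y = S x := by
    intro x
    have := S.mem_graph x
    rw [hS] at this
    exact (hG _).mp this
  have hSdense : Dense (S.domain : Set E) := by
    refine hdense.mono ?_
    intro x hx
    have h1 : B (x + T ⟨x, hx⟩) = x := by
      rw [hB, add_sub_cancel_left]
      exact T.mem_graph ⟨x, hx⟩
    exact (hSdom x).mpr ⟨C (x + T ⟨x, hx⟩), by rw [hCC', h1]⟩
  have hSsymm : S.IsFormalAdjoint S := by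
    intro x x'
    obtain ⟨y, h1, h2⟩ := hSval x
    obtain ⟨y', h1', h2'⟩ := hSval x'
    rw [← h1, ← h2, ← h1', ← h2', hCs, hDs, hCD']
  refine ⟨S, ?_, ?_, ?_⟩
  · rw [LinearPMap.isSelfAdjoint_def]
    refine le_antisymm ?_ (hSsymm.le_adjoint hSdense)
    refine LinearPMap.le_of_le_graph ?_
    rintro ⟨v, w⟩ hvw
    rw [LinearPMap.mem_graph_iff] at hvw
    obtain ⟨z, hz1, hz2⟩ := hvw
    change (z : E) = v at hz1
    change S.adjoint z = w at hz2
    have hkey : ∀ y : E, inner ℂ y (D v) = inner ℂ y (C w) := by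
      intro y
      have hy : C y ∈ S.domain := (hSdom _).mpr ⟨y, rfl⟩
      have hSy : S ⟨C y, hy⟩ = D y := by
        obtain ⟨y', h1, h2⟩ := hSval ⟨C y, hy⟩
        have : y' = y := by
          have h3 := hCinj (y' - y) (by rw [map_sub]; exact sub_eq_zero.mpr h1)
          exact sub_eq_zero.mp h3
        rw [← h2, this]
      have h := (LinearPMap.adjoint_isFormalAdjoint hSdense).symm ⟨C y, hy⟩ z
      rw [hSy, hz1, hz2] at h
      rw [← hDs, h, hCs]
    have hDv : D v = C w := ext_inner_left ℂ hkey
    rw [hS, hG]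
    have hv : v = C (C v + D w) := by
      have h1 : D (D v) = v - B v := hDD' v
      rw [hDv, ← hCD'] at h1
      rw [map_add, hCC', h1]
      abel
    refine ⟨C v + D w, hv.symm, ?_⟩
    have h1 : D (D w) = w - B w := hDD' w
    change D (C v + D w) = w
    rw [map_add, ← hCD', hDv, hCC', h1]
    abel
  · intro x
    obtain ⟨y, h1, h2⟩ := hSval x
    rw [← h1, ← h2]
    have h3 := (ContinuousLinearMap.nonneg_iff_isPositive _).mp hCD0
    have h4 := h3.re_inner_nonneg_right y
    rw [hCs]
    exact h4
  · intro x y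
    rw [hS]
    constructor
    · intro hxy
      have h1 : B (x + y) = x := by
        rw [hB, add_sub_cancel_left]
        exact hxy
      refine ⟨D (C (x + y)), (hG _).mpr ⟨C (x + y), ?_, rfl⟩, (hG _).mpr ⟨D (x + y), ?_, ?_⟩⟩
      · change C (C (x + y)) = x
        rw [hCC', h1]
      · exact hCD' _
      · change D (D (x + y)) = y
        rw [hDD', h1]
        abel
    · rintro ⟨z, hz1, hz2⟩
      obtain ⟨p, hp1, hp2⟩ := (hG _).mp hz1
      obtain ⟨q, hq1, hq2⟩ := (hG _).mp hz2
      change C p = x at hp1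
      change D p = z at hp2
      change C q = z at hq1
      change D q = y at hq2
      have hp : p = C (x + y) := by
        have h1 : D (D p) = p - B p := hDD' p
        rw [hp2, ← hq1, ← hCD', hq2] at h1
        rw [map_add, h1, ← hp1, hCC']
        abel
      have h2 : B (x + y) = x := by rw [← hCC', ← hp, hp1]
      rw [hB, add_sub_cancel_left] at h2
      exact h2

open Classical in
/-- The positive square root `T ^ (1/2)` of a self-adjoint operator `T ≥ 0`. It is unique, and it
exists by `exists_isPosSqrt`. -/
def posSqrt [CompleteSpace E] (T : E →ₗ.[ℂ] E) : E →ₗ.[ℂ] E :=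
  if h : ∃ S : E →ₗ.[ℂ] E, IsPosSqrt S T then h.choose else ⊥

theorem isPosSqrt_posSqrt [CompleteSpace E] {T : E →ₗ.[ℂ] E} (hT : IsSelfAdjoint T) (hpos : IsNonneg T) :
    IsPosSqrt (posSqrt T) T := by
  have h := exists_isPosSqrt hT hpos
  rw [posSqrt, dif_pos h]
  exact h.choose_spec

theorem isSelfAdjoint_neg [CompleteSpace E] {T : E →ₗ.[ℂ] E} (hT : IsSelfAdjoint T) :
    IsSelfAdjoint (-T) := by
  have hdense := hT.dense_domain
  have hdense' : Dense ((-T).domain : Set E) := hdense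
  have hT' : T.adjoint = T := hT
  have hsymm : T.IsFormalAdjoint T := by
    have h := LinearPMap.adjoint_isFormalAdjoint hdense
    rwa [hT'] at h
  have hnegsymm : (-T).IsFormalAdjoint (-T) := by
    intro x y
    have h := hsymm x y
    rw [LinearPMap.neg_apply, LinearPMap.neg_apply, inner_neg_left, inner_neg_right, h]
  rw [LinearPMap.isSelfAdjoint_def]
  refine le_antisymm ?_ (hnegsymm.le_adjoint hdense')
  refine LinearPMap.le_of_le_graph ?_
  rintro ⟨v, w⟩ hvw
  rw [LinearPMap.mem_graph_iff] at hvw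
  obtain ⟨z, hz1, hz2⟩ := hvw
  change (z : E) = v at hz1
  change (-T).adjoint z = w at hz2
  have hkey : ∀ x : T.domain, inner ℂ (-w) (x : E) = inner ℂ v (T x) := by
    intro x
    have h := LinearPMap.adjoint_isFormalAdjoint hdense' z x
    rw [hz2, hz1, LinearPMap.neg_apply, inner_neg_right] at h
    rw [inner_neg_left, h, neg_neg]
  have hv : v ∈ T.adjoint.domain := LinearPMap.mem_adjoint_domain_of_exists v ⟨-w, hkey⟩
  have hval : T.adjoint ⟨v, hv⟩ = -w := LinearPMap.adjoint_apply_eq hdense ⟨v, hv⟩ hkey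
  have hg : (v, -w) ∈ T.graph := by
    have : (v, -w) ∈ T.adjoint.graph := by
      rw [← hval]
      exact T.adjoint.mem_graph ⟨v, hv⟩
    rwa [hT'] at this
  rw [LinearPMap.mem_graph_iff] at hg ⊢
  obtain ⟨x, hx1, hx2⟩ := hg
  change T x = -w at hx2
  refine ⟨x, hx1, ?_⟩
  change (-T) x = w
  rw [LinearPMap.neg_apply, hx2, neg_neg]

theorem isNonneg_neg {T : E →ₗ.[ℂ] E} (hT : IsNonpos T) : IsNonneg (-T) := by
  intro x
  have h := hT x
  rw [LinearPMap.neg_apply, inner_neg_right, Complex.neg_re]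
  linarith

end Operators

/-! ### The differential expression `d/dt + A` on an open interval -/

section Differential

variable {H : Type*} [NormedAddCommGroup H] [InnerProductSpace ℂ H]

/-- The Hilbert space `L²(H, I)`. -/
abbrev L2 (H : Type*) [NormedAddCommGroup H] (I : Set ℝ) : Type _ :=
  Lp H 2 (volume.restrict I)

/-- Scalar smooth functions on the real line with compact support. -/
def TestFun : Type :=
  {phi : ℝ → ℂ // ContDiff ℝ ∞ phi ∧ HasCompactSupport phi}

/-- The derivative of a test function. -/
def TestFun.derivative (phi : TestFun) : TestFun :=
  ⟨deriv phi.1, (contDiff_infty_iff_deriv.mp phi.2.1).2, phi.2.2.deriv⟩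

theorem TestFun.memLp_smul (phi : TestFun) (g : H) (I : Set ℝ) :
    MemLp (fun t => phi.1 t • g) 2 (volume.restrict I) := by
  have h1 : Continuous (fun t => phi.1 t • g) := phi.2.1.continuous.smul continuous_const
  exact (h1.memLp_of_hasCompactSupport phi.2.2.smul_right).restrict I

/-- The vector function `t ↦ φ(t) g`, as an element of `L²(H, I)`. -/
def tensor (I : Set ℝ) (phi : TestFun) (g : H) : L2 H I :=
  (phi.memLp_smul g I).toLp _

/-- The graph of `s d/dt + A` on the finite sums of vector functions `φ(t) g` with
`φ ∈ C₀^∞(I)` and `g ∈ D(A)`. -/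
def testGraph (s : ℝ) (A : H →ₗ.[ℂ] H) (I : Set ℝ) : Submodule ℂ (L2 H I × L2 H I) :=
  Submodule.span ℂ {p | ∃ (phi : TestFun) (g : A.domain), tsupport phi.1 ⊆ I ∧
    p = (tensor I phi (g : H), (s : ℂ) • tensor I phi.derivative (g : H) + tensor I phi (A g))}

/-- The operator `s d/dt + A` on the finite sums of vector functions `φ(t) g` with
`φ ∈ C₀^∞(I)` and `g ∈ D(A)`. -/
def testOperator (s : ℝ) (A : H →ₗ.[ℂ] H) (I : Set ℝ) : L2 H I →ₗ.[ℂ] L2 H I :=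
  (testGraph s A I).toLinearPMap

theorem inner_tensor_left {I : Set ℝ} (phi : TestFun) (g : H) (u : L2 H I) :
    inner ℂ (tensor I phi g) u = ∫ t in I, inner ℂ (phi.1 t • g) (u t) := by
  rw [L2.inner_def]
  refine integral_congr_ae ?_
  filter_upwards [(phi.memLp_smul g I).coeFn_toLp] with t ht
  rw [tensor, ht]

theorem inner_tensor_tensor {I : Set ℝ} (phi psi : TestFun) (g h : H)
    (hI : tsupport phi.1 ⊆ I) :
    inner ℂ (tensor I phi g) (tensor I psi h) =
      (∫ t, star (phi.1 t) * psi.1 t) * inner ℂ g h := by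
  rw [inner_tensor_left, ← integral_mul_const]
  have h1 : ∫ t in I, inner ℂ (phi.1 t • g) (tensor I psi h t) =
      ∫ t in I, star (phi.1 t) * psi.1 t * inner ℂ g h := by
    refine integral_congr_ae ?_
    filter_upwards [(psi.memLp_smul h I).coeFn_toLp] with t ht
    rw [tensor, ht, inner_smul_left, inner_smul_right, mul_assoc]
    rfl
  rw [h1]
  refine setIntegral_eq_integral_of_forall_compl_eq_zero fun t ht => ?_
  have : phi.1 t = 0 := image_eq_zero_of_notMem_tsupport fun h => ht (hI h)
  rw [this, star_zero, zero_mul, zero_mul]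

theorem TestFun.integral_by_parts (phi psi : TestFun) :
    (∫ t, star (phi.derivative.1 t) * psi.1 t) = -∫ t, star (phi.1 t) * psi.derivative.1 t := by
  have hd : ∀ chi : TestFun, ∀ t, HasDerivAt chi.1 (chi.derivative.1 t) t := fun chi t =>
    ((chi.2.1.differentiable (by simp)) t).hasDerivAt
  have hint : ∀ a b : TestFun, Integrable (fun t => star (a.1 t) * b.1 t) := by
    intro a b
    have hc : Continuous (fun t => star (a.1 t) * b.1 t) :=
      (continuous_star.comp a.2.1.continuous).mul b.2.1.continuous
    exact hc.integrable_of_hasCompactSupport b.2.2.mul_left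
  have h := integral_eq_zero_of_hasDerivAt_of_integrable
    (f := fun t => star (phi.1 t) * psi.1 t)
    (f' := fun t => star (phi.derivative.1 t) * psi.1 t + star (phi.1 t) * psi.derivative.1 t)
    (fun t => (hd phi t).star.mul (hd psi t))
    ((hint _ _).add (hint _ _)) (hint _ _)
  rw [integral_add (hint _ _) (hint _ _)] at h
  linear_combination h

/-- The test vector functions are dense in `L²(H, I)`. -/
theorem dense_testGraph [CompleteSpace H] (s : ℝ) {A : H →ₗ.[ℂ] H}
    (hA : Dense (A.domain : Set H)) {I : Set ℝ} (hI : IsOpen I) :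
    Dense ((testOperator s A I).domain : Set (L2 H I)) := by
  rw [Submodule.dense_iff_topologicalClosure_eq_top, Submodule.topologicalClosure_eq_top_iff,
    Submodule.eq_bot_iff]
  intro u hu
  have hloc : LocallyIntegrableOn (fun t => u t) I volume := by
    have h1 : LocallyIntegrable (fun t => u t) (volume.restrict I) :=
      (Lp.memLp u).locallyIntegrable (by norm_num)
    rw [locallyIntegrableOn_iff hI.isLocallyClosed]
    intro k hkI hk
    have h2 := h1.integrableOn_isCompact hk
    rwa [IntegrableOn, Measure.restrict_restrict hk.measurableSet,
      Set.inter_eq_self_of_subset_left hkI] at h2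
  have key := hI.ae_eq_zero_of_integral_contDiff_smul_eq_zero hloc (by
    intro r hr hrc hrI
    refine hA.eq_zero_of_inner_right ℂ fun g hg => ?_
    let phi : TestFun := ⟨fun t => (r t : ℂ), Complex.ofRealCLM.contDiff.comp hr,
      hrc.comp_left (g := fun x : ℝ => (x : ℂ)) Complex.ofReal_zero⟩
    have hphiI : tsupport phi.1 ⊆ I :=
      (closure_mono (Function.support_comp_subset (g := fun x : ℝ => (x : ℂ))
        Complex.ofReal_zero r)).trans hrI
    have hmem : tensor I phi g ∈ (testOperator s A I).domain := by
      rw [testOperator, Submodule.toLinearPMap_domain]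
      exact ⟨_, Submodule.subset_span ⟨phi, ⟨g, hg⟩, hphiI, rfl⟩, rfl⟩
    have h0 := (Submodule.mem_orthogonal _ _).mp hu _ hmem
    rw [inner_tensor_left] at h0
    have hint : Integrable (fun t => r t • u t) := by
      have h3 : LocallyIntegrable (fun t => u t) (volume.restrict I) :=
        (Lp.memLp u).locallyIntegrable (by norm_num)
      have h4 := h3.integrable_smul_left_of_hasCompactSupport hr.continuous hrc
      refine (integrableOn_iff_integrable_of_support_subset ?_).mp h4
      intro t ht
      by_contra hti
      refine ht ?_
      have : r t = 0 := image_eq_zero_of_notMem_tsupport fun h => hti (hrI h)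
      simp [this]
    have h5 : ∫ t, r t • u t = ∫ t in I, r t • u t := by
      refine (setIntegral_eq_integral_of_forall_compl_eq_zero fun t ht => ?_).symm
      have : r t = 0 := image_eq_zero_of_notMem_tsupport fun h => ht (hrI h)
      rw [this, zero_smul]
    rw [h5, ← integral_inner hint.integrableOn, ← h0]
    refine integral_congr_ae (Filter.Eventually.of_forall fun t => ?_)
    change inner ℂ g (r t • u t) = inner ℂ ((r t : ℂ) • g) (u t)
    rw [inner_smul_left, Complex.conj_ofReal, ← inner_smul_right]
    rfl)
  refine Lp.eq_zero_iff_ae_eq_zero.mpr ?_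
  exact (ae_restrict_iff' hI.measurableSet).mpr key

/-- Green's formula for test vector functions. -/
theorem testGraph_green (s : ℝ) {A : H →ₗ.[ℂ] H} (hA : A.IsFormalAdjoint A) {I : Set ℝ}
    {p q : L2 H I × L2 H I} (hp : p ∈ testGraph s A I) (hq : q ∈ testGraph (-s) A I) :
    inner ℂ p.2 q.1 = inner ℂ p.1 q.2 := by
  induction hp using Submodule.span_induction with
  | zero => simp
  | add a b _ _ ha hb => simp [inner_add_left, ha, hb]
  | smul c a _ ha => simp [inner_smul_left, ha]
  | mem p hp =>
    induction hq using Submodule.span_induction with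
    | zero => simp
    | add a b _ _ ha hb => simp [inner_add_right, ha, hb]
    | smul c a _ ha => simp [inner_smul_right, ha]
    | mem q hq =>
      obtain ⟨phi, g, hphi, rfl⟩ := hp
      obtain ⟨psi, h, hpsi, rfl⟩ := hq
      have hphi' : tsupport phi.derivative.1 ⊆ I :=
        (closure_minimal support_deriv_subset (isClosed_tsupport _)).trans hphi
      simp only [inner_add_left, inner_add_right, inner_smul_left, inner_smul_right,
        inner_tensor_tensor _ _ _ _ hphi, inner_tensor_tensor _ _ _ _ hphi', hA g h,
        TestFun.integral_by_parts phi psi]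
      simp

theorem testGraph_single_valued [CompleteSpace H] (s : ℝ) {A : H →ₗ.[ℂ] H}
    (hA : IsSelfAdjoint A) {I : Set ℝ} (hI : IsOpen I) :
    ∀ p ∈ testGraph s A I, p.1 = 0 → p.2 = 0 := by
  intro p hp h0
  have hsymm : A.IsFormalAdjoint A := by
    have h := LinearPMap.adjoint_isFormalAdjoint hA.dense_domain
    rwa [LinearPMap.isSelfAdjoint_def.mp hA] at h
  refine (dense_testGraph (-s) hA.dense_domain hI).eq_zero_of_inner_left ℂ fun v hv => ?_
  rw [testOperator, Submodule.toLinearPMap_domain] at hv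
  obtain ⟨q, hq, rfl⟩ := hv
  rw [LinearMap.fst_apply, testGraph_green s hsymm hp hq, h0, inner_zero_left]

theorem testOperator_graph [CompleteSpace H] (s : ℝ) {A : H →ₗ.[ℂ] H}
    (hA : IsSelfAdjoint A) {I : Set ℝ} (hI : IsOpen I) :
    (testOperator s A I).graph = testGraph s A I :=
  Submodule.toLinearPMap_graph_eq _ (testGraph_single_valued s hA hI)

/-- The operators `s d/dt + A` and `-s d/dt + A` on test vector functions are formally adjoint. -/
theorem testOperator_isFormalAdjoint [CompleteSpace H] (s : ℝ) {A : H →ₗ.[ℂ] H}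
    (hA : IsSelfAdjoint A) {I : Set ℝ} (hI : IsOpen I) :
    (testOperator s A I).IsFormalAdjoint (testOperator (-s) A I) := by
  intro x y
  have hsymm : A.IsFormalAdjoint A := by
    have h := LinearPMap.adjoint_isFormalAdjoint hA.dense_domain
    rwa [LinearPMap.isSelfAdjoint_def.mp hA] at h
  have hx := (testOperator s A I).mem_graph x
  have hy := (testOperator (-s) A I).mem_graph y
  rw [testOperator_graph _ hA hI] at hx hy
  exact testGraph_green s hsymm hx hy

/-- `d/dt + A` on the test vector functions is closable, so that its closure makes sense. -/
theorem testOperator_isClosable [CompleteSpace H] (s : ℝ) {A : H →ₗ.[ℂ] H}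
    (hA : IsSelfAdjoint A) {I : Set ℝ} (hI : IsOpen I) : (testOperator s A I).IsClosable := by
  have hd := dense_testGraph (-s) hA.dense_domain hI
  exact (LinearPMap.adjoint_isClosed hd).isClosable.leIsClosable
    ((testOperator_isFormalAdjoint s hA hI).symm.le_adjoint hd)

/-- The minimal operator generated by `d/dt + A` in `L²(H, I)`: the closure of `d/dt + A` on the
test vector functions. -/
def minimalOperator (A : H →ₗ.[ℂ] H) (I : Set ℝ) : L2 H I →ₗ.[ℂ] L2 H I :=
  (testOperator 1 A I).closure

/-- The maximal operator generated by `d/dt + A` in `L²(H, I)`: the adjoint of the formally adjoint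
expression `-d/dt + A` on the test vector functions. Its domain consists of all `u ∈ L²(H, I)` for
which `u' + A u`, in the weak sense, belongs to `L²(H, I)`. -/
def maximalOperator [CompleteSpace H] (A : H →ₗ.[ℂ] H) (I : Set ℝ) : L2 H I →ₗ.[ℂ] L2 H I :=
  (testOperator (-1) A I).adjoint

/-- The function `u` in the domain of the maximal operator `L` in `L²(H, I)` has the boundary value
`u(a) = f` at the end point `a` of the half-line `I`, in the sense of Green's formula
`(φ g, L u) - (- φ' g + φ A g, u) = σ (φ(a) g, f)` for all test functions `φ` on the real line and
all `g ∈ D(A)`; here `σ = 1` if `a` is the right end point of `I`, and `σ = -1` if it is the left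
end point. For `u` differentiable up to the boundary this is integration by parts. -/
def HasBoundaryValue [CompleteSpace H] (sigma : ℝ) (A : H →ₗ.[ℂ] H) (I : Set ℝ) (a : ℝ) (u : L2 H I) (f : H) :
    Prop :=
  ∃ hu : u ∈ (maximalOperator A I).domain, ∀ (phi : TestFun) (g : A.domain),
    inner ℂ (tensor I phi (g : H)) (maximalOperator A I ⟨u, hu⟩) -
        inner ℂ (-tensor I phi.derivative (g : H) + tensor I phi (A g)) u =
      (sigma : ℂ) * inner ℂ (phi.1 a • (g : H)) f

/-- The minimal operator `L₀(1, 0, 1)` generated by `d/dt + A₁` on `(-∞, a₁)` and `d/dt + A₃` on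
`(a₃, ∞)`, in `L²(H, (-∞, a₁)) ⊕ L²(H, (a₃, ∞))`. -/
def minimalOperatorSum [CompleteSpace H] (A₁ A₃ : H →ₗ.[ℂ] H) (a₁ a₃ : ℝ) :
    WithLp 2 (L2 H (Iio a₁) × L2 H (Ioi a₃)) →ₗ.[ℂ] WithLp 2 (L2 H (Iio a₁) × L2 H (Ioi a₃)) :=
  dirSum (minimalOperator A₁ (Iio a₁)) (minimalOperator A₃ (Ioi a₃))

/-- The maximal operator `L(1, 0, 1)`. -/
def maximalOperatorSum [CompleteSpace H] (A₁ A₃ : H →ₗ.[ℂ] H) (a₁ a₃ : ℝ) :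
    WithLp 2 (L2 H (Iio a₁) × L2 H (Ioi a₃)) →ₗ.[ℂ] WithLp 2 (L2 H (Iio a₁) × L2 H (Ioi a₃)) :=
  dirSum (maximalOperator A₁ (Iio a₁)) (maximalOperator A₃ (Ioi a₃))

/-- The boundary conditions `u₃(a₃) = W u₁(a₁)`, `u₁(a₁) ∈ ker (-A₁)^(1/2)`,
`u₃(a₃) ∈ ker A₃^(1/2)`. -/
def boundaryConditions [CompleteSpace H] (A₁ A₃ : H →ₗ.[ℂ] H) (a₁ a₃ : ℝ) (W : H ≃ₗᵢ[ℂ] H) :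
    Submodule ℂ (WithLp 2 (L2 H (Iio a₁) × L2 H (Ioi a₃))) where
  carrier := {u | ∃ f₁ f₃ : H,
    HasBoundaryValue 1 A₁ (Iio a₁) a₁ u.fst f₁ ∧ HasBoundaryValue (-1) A₃ (Ioi a₃) a₃ u.snd f₃ ∧
    f₃ = W f₁ ∧ f₁ ∈ kernel (posSqrt (-A₁)) ∧ f₃ ∈ kernel (posSqrt A₃)}
  zero_mem' := by
    refine ⟨0, 0, ⟨Submodule.zero_mem _, fun phi g => ?_⟩, ⟨Submodule.zero_mem _, fun phi g => ?_⟩,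
      by simp, Submodule.zero_mem _, Submodule.zero_mem _⟩
    · have h := (maximalOperator A₁ (Iio a₁)).map_zero
      rw [inner_zero_right, mul_zero]
      change inner ℂ _ ((maximalOperator A₁ (Iio a₁)) 0) - inner ℂ _ (0 : L2 H (Iio a₁)) = 0
      rw [h, inner_zero_right, inner_zero_right, sub_zero]
    · have h := (maximalOperator A₃ (Ioi a₃)).map_zero
      rw [inner_zero_right, mul_zero]
      change inner ℂ _ ((maximalOperator A₃ (Ioi a₃)) 0) - inner ℂ _ (0 : L2 H (Ioi a₃)) = 0
      rw [h, inner_zero_right, inner_zero_right, sub_zero]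
  add_mem' := by
    rintro u v ⟨f₁, f₃, ⟨hu1, hf1⟩, ⟨hu3, hf3⟩, hW, hk1, hk3⟩
      ⟨g₁, g₃, ⟨hv1, hg1⟩, ⟨hv3, hg3⟩, hW', hl1, hl3⟩
    refine ⟨f₁ + g₁, f₃ + g₃, ⟨Submodule.add_mem _ hu1 hv1, fun phi g => ?_⟩,
      ⟨Submodule.add_mem _ hu3 hv3, fun phi g => ?_⟩, by rw [hW, hW', map_add],
      Submodule.add_mem _ hk1 hl1, Submodule.add_mem _ hk3 hl3⟩
    · have h := (maximalOperator A₁ (Iio a₁)).map_add ⟨u.fst, hu1⟩ ⟨v.fst, hv1⟩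
      have e1 := hf1 phi g
      have e2 := hg1 phi g
      change inner ℂ _ ((maximalOperator A₁ (Iio a₁)) (⟨u.fst, hu1⟩ + ⟨v.fst, hv1⟩)) -
        inner ℂ _ (u.fst + v.fst) = _
      rw [h]
      simp only [inner_add_right] at e1 e2 ⊢
      linear_combination e1 + e2
    · have h := (maximalOperator A₃ (Ioi a₃)).map_add ⟨u.snd, hu3⟩ ⟨v.snd, hv3⟩
      have e1 := hf3 phi g
      have e2 := hg3 phi g
      change inner ℂ _ ((maximalOperator A₃ (Ioi a₃)) (⟨u.snd, hu3⟩ + ⟨v.snd, hv3⟩)) -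
        inner ℂ _ (u.snd + v.snd) = _
      rw [h]
      simp only [inner_add_right] at e1 e2 ⊢
      linear_combination e1 + e2
  smul_mem' := by
    rintro c u ⟨f₁, f₃, ⟨hu1, hf1⟩, ⟨hu3, hf3⟩, hW, hk1, hk3⟩
    refine ⟨c • f₁, c • f₃, ⟨Submodule.smul_mem _ c hu1, fun phi g => ?_⟩,
      ⟨Submodule.smul_mem _ c hu3, fun phi g => ?_⟩, by rw [hW, map_smul],
      Submodule.smul_mem _ c hk1, Submodule.smul_mem _ c hk3⟩
    · have h := (maximalOperator A₁ (Iio a₁)).map_smul c ⟨u.fst, hu1⟩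
      have e1 := hf1 phi g
      change inner ℂ _ ((maximalOperator A₁ (Iio a₁)) (c • ⟨u.fst, hu1⟩)) -
        inner ℂ _ (c • u.fst) = _
      rw [h]
      simp only [inner_smul_right] at e1 ⊢
      linear_combination c * e1
    · have h := (maximalOperator A₃ (Ioi a₃)).map_smul c ⟨u.snd, hu3⟩
      have e1 := hf3 phi g
      change inner ℂ _ ((maximalOperator A₃ (Ioi a₃)) (c • ⟨u.snd, hu3⟩)) -
        inner ℂ _ (c • u.snd) = _
      rw [h]
      simp only [inner_smul_right] at e1 ⊢
      linear_combination c * e1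

/-- The operator `L_W` generated by the differential expression and the boundary conditions
`u₃(a₃) = W u₁(a₁)`, `u₁(a₁) ∈ ker (-A₁)^(1/2)`, `u₃(a₃) ∈ ker A₃^(1/2)`: the restriction of the
maximal operator to the functions which satisfy them. -/
def boundaryOperator [CompleteSpace H] (A₁ A₃ : H →ₗ.[ℂ] H) (a₁ a₃ : ℝ) (W : H ≃ₗᵢ[ℂ] H) :
    WithLp 2 (L2 H (Iio a₁) × L2 H (Ioi a₃)) →ₗ.[ℂ] WithLp 2 (L2 H (Iio a₁) × L2 H (Ioi a₃)) :=
  (maximalOperatorSum A₁ A₃ a₁ a₃).domRestrict (boundaryConditions A₁ A₃ a₁ a₃ W)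

end Differential

end NormalExtension

end

noncomputable section

namespace NormalExtension

/-! ### Translates of a test function as mollifiers -/

section Mollification

variable {G : Type*} [NormedAddCommGroup G] [NormedSpace ℝ G]

/-! Normal extensions. Let `x` be an eigenvector of a normal `N` for `lam`. Then `N* x = conj lam •
x`, and on test vectors `N` acts as `d/dt + A` while `N*` acts as `-d/dt + A`. Subtracting the two,
`A` cancels and `x' = i (Im lam) x` holds weakly on each half-line. Such functions have constant
modulus, so none but zero is square integrable. The carriers are `IsNormal.inner_sub_eigenvector`
and the scalar lemma `ae_eq_zero_of_weak_ode_Iio` with its mirror image.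

Boundary conditions. Extended by zero to the line, the two components of an eigenfunction solve `w'
+ A w = lam w` with a point source at the end point, given up to sign by the boundary value `f`.
Since `A f = 0`, the scalar function `(f, w)` satisfies `y' = lam y` with a jump. If `Re lam ≤ 0`,
then `exp (lam t)` is not square integrable at `-∞`, so `y = 0` on the left, and the jump gives `f₁
= 0`; if `Re lam ≥ 0`, the same on the right gives `f₃ = 0`. As `W` is injective, both vanish in
either case. Without a source, the sign of `A` makes `exp (-2 Re lam t) ‖w‖²` monotone on the line.
It vanishes beyond the end point, where `w` was extended by zero, and monotonicity carries this into
the half-line (`IsWeakSolution.ae_eq_zero`).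

Every weak equation becomes a classical one for `U t = ∫ phi (s - t) • w s`, whose value at `t = 0`
is the pairing of `w` with `phi`. -/

theorem hasDerivAt_integral_translate_smul [CompleteSpace G] {w : ℝ → G} (hw : LocallyIntegrable w)
    {phi : ℝ → ℝ} (h : ContDiff ℝ ∞ phi) (hc : HasCompactSupport phi) (t : ℝ) :
    HasDerivAt (fun t => ∫ s, phi (s - t) • w s) (-∫ s, deriv phi (s - t) • w s) t := by
  have hc' : HasCompactSupport (fun s => phi (-s)) :=
    hc.comp_homeomorph (Homeomorph.neg ℝ)
  have h' : ContDiff ℝ 1 (fun s => phi (-s)) := (h.comp contDiff_neg).of_le (by simp)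
  have key := hc'.hasDerivAt_convolution_left (ContinuousLinearMap.lsmul ℝ ℝ) h' hw t
  have e1 : (convolution (fun s => phi (-s)) w (ContinuousLinearMap.lsmul ℝ ℝ) volume) =
      fun t => ∫ s, phi (s - t) • w s := by
    funext t
    rw [convolution_lsmul_swap]
    simp only [neg_sub]
  have e2 : (convolution (deriv fun s => phi (-s)) w (ContinuousLinearMap.lsmul ℝ ℝ) volume) t =
      -∫ s, deriv phi (s - t) • w s := by
    rw [convolution_lsmul_swap, ← integral_neg]
    refine integral_congr_ae (Filter.Eventually.of_forall fun s => ?_)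
    simp only [deriv_comp_neg, neg_sub, neg_smul]
  rwa [e1, e2] at key

/-- The integral sees `w` only on a window that moves off to `-∞`, where the `L²` tail is small.
This replaces square integrability as the decay condition in the scalar equation. -/
theorem tendsto_integral_translate_smul_atBot {w : ℝ → G} (hw : MemLp w 2)
    {phi : ℝ → ℝ} (h : Continuous phi) (hc : HasCompactSupport phi) :
    Filter.Tendsto (fun t => ∫ s, phi (s - t) • w s) Filter.atBot (nhds 0) := by
  obtain ⟨R, hR⟩ := hc.isCompact.isBounded.subset_closedBall 0
  have hphi : Integrable (fun s => phi s ^ 2) :=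
    (h.memLp_of_hasCompactSupport (p := 2) hc).integrable_sq
  have hw2 : Integrable (fun s => ‖w s‖ ^ 2) := hw.integrable_norm_pow (by norm_num)
  have htail : Filter.Tendsto (fun x => ∫ s in Iic x, ‖w s‖ ^ 2) Filter.atBot (nhds 0) :=
    tendsto_integral_Iic_zero Filter.tendsto_id
  -- Weighted inequality `2ab ≤ e a² + b² / e`, with a spare factor 2; the radius `R` of the support
  -- confines `w` to `Iic (t + R)`.
  have hbound : ∀ e > 0, ∀ t, ‖∫ s, phi (s - t) • w s‖ ≤
      e * (∫ s, phi s ^ 2) + e⁻¹ * ∫ s in Iic (t + R), ‖w s‖ ^ 2 := by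
    intro e he t
    have i1 : Integrable (fun s => e * phi (s - t) ^ 2) := (hphi.comp_sub_right t).const_mul e
    have i2 : Integrable (fun s => e⁻¹ * (Iic (t + R)).indicator (fun s => ‖w s‖ ^ 2) s) :=
      (hw2.indicator measurableSet_Iic).const_mul _
    have h1 : ‖∫ s, phi (s - t) • w s‖ ≤
        ∫ s, (e * phi (s - t) ^ 2 + e⁻¹ * (Iic (t + R)).indicator (fun s => ‖w s‖ ^ 2) s) := by
      refine norm_integral_le_of_norm_le (i1.add i2) (Filter.Eventually.of_forall fun s => ?_)
      by_cases hs : s - t ∈ tsupport phi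
      · have h2 : s ∈ Iic (t + R) := by
          have := hR hs
          rw [mem_closedBall_zero_iff, Real.norm_eq_abs] at this
          rw [mem_Iic]
          linarith [le_abs_self (s - t)]
        rw [indicator_of_mem h2, norm_smul, Real.norm_eq_abs, ← sq_abs]
        have h3 := mul_inv_cancel₀ he.ne'
        have h4 : 0 ≤ e⁻¹ * (‖w s‖ - e * |phi (s - t)|) ^ 2 := by positivity
        have h5 : e⁻¹ * (‖w s‖ - e * |phi (s - t)|) ^ 2 = e⁻¹ * ‖w s‖ ^ 2 -
            2 * (|phi (s - t)| * ‖w s‖) + e * |phi (s - t)| ^ 2 := by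
          field_simp
          ring
        have h6 : 0 ≤ |phi (s - t)| * ‖w s‖ := by positivity
        linarith
      · rw [image_eq_zero_of_notMem_tsupport hs, zero_smul, norm_zero]
        have : 0 ≤ (Iic (t + R)).indicator (fun s => ‖w s‖ ^ 2) s :=
          indicator_nonneg (fun _ _ => by positivity) s
        positivity
    rw [integral_add i1 i2, integral_const_mul, integral_const_mul,
      integral_sub_right_eq_self (fun s => phi s ^ 2), integral_indicator measurableSet_Iic] at h1
    exact h1
  rw [tendsto_zero_iff_norm_tendsto_zero, Metric.tendsto_nhds]
  intro r hr
  set C := ∫ s, phi s ^ 2 with hC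
  have hC0 : 0 ≤ C := integral_nonneg fun _ => sq_nonneg _
  -- This choice makes `e * C ≤ r / 2`; the `+ 1` covers `C = 0`.
  set e := r / (2 * (C + 1)) with he
  have he0 : 0 < e := by positivity
  have htail' := (htail.comp (Filter.tendsto_atBot_add_const_right _ R Filter.tendsto_id)).const_mul
    e⁻¹
  rw [mul_zero] at htail'
  filter_upwards [htail'.eventually (gt_mem_nhds (half_pos hr))] with t ht
  rw [dist_zero_right, norm_norm]
  refine (hbound e he0 t).trans_lt ?_
  have h1 : e * C ≤ r / 2 := by
    rw [he, div_mul_eq_mul_div, div_le_div_iff₀ (by positivity) (by norm_num)]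
    nlinarith
  have h2 : e⁻¹ * ∫ s in Iic (t + R), ‖w s‖ ^ 2 < r / 2 := ht
  linarith

end Mollification

/-! ### The scalar equation on a half-line -/

/-- A square integrable weak solution of `y' = lam y` on a left half-line vanishes if
`Re lam ≤ 0`. -/
theorem ae_eq_zero_of_weak_ode_Iio {lam : ℂ} (hlam : lam.re ≤ 0) {y : ℝ → ℂ} (hy : MemLp y 2)
    {a : ℝ} (h : ∀ phi : ℝ → ℝ, ContDiff ℝ ∞ phi → HasCompactSupport phi →
      tsupport phi ⊆ Iio a → ∫ s, deriv phi s • y s = -lam * ∫ s, phi s • y s) :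
    ∀ᵐ s, s ∈ Iio a → y s = 0 := by
  have hloc : LocallyIntegrable y := hy.locallyIntegrable (by norm_num)
  refine isOpen_Iio.ae_eq_zero_of_integral_contDiff_smul_eq_zero (hloc.locallyIntegrableOn _) ?_
  intro phi hphi hc hsupp
  set Y : ℝ → ℂ := fun t => ∫ s, phi (s - t) • y s with hY
  -- Shifting `phi` to the left keeps its support in `Iio a`, so the weak equation is available
  -- exactly for these translates.
  have hder : ∀ t : ℝ, t ≤ 0 → HasDerivAt Y (lam * Y t) t := by
    intro t ht
    have h1 := hasDerivAt_integral_translate_smul hloc hphi hc t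
    have hts : tsupport (fun s => phi (s - t)) ⊆ Iio a := by
      intro s hs
      have h2 : s - t ∈ tsupport phi :=
        tsupport_comp_subset_preimage phi (f := fun s => s - t) (by fun_prop) hs
      have h3 := hsupp h2
      rw [mem_Iio] at h3 ⊢
      linarith
    have h2 := h (fun s => phi (s - t)) (hphi.comp (contDiff_id.sub contDiff_const))
      (hc.comp_homeomorph (Homeomorph.subRight t)) hts
    simp only [deriv_comp_sub_const] at h2
    rw [h2, neg_mul, neg_neg] at h1
    exact h1
  have hconst : ∀ t : ℝ, t ≤ 0 → Complex.exp (-lam * t) * Y t = Y 0 := by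
    have hd : ∀ t : ℝ, t ≤ 0 → HasDerivAt (fun t : ℝ => Complex.exp (-lam * t) * Y t) 0 t := by
      intro t ht
      have h1 : HasDerivAt (fun t : ℝ => Complex.exp (-lam * t))
          (Complex.exp (-lam * t) * (-lam * 1)) t :=
        (((Complex.ofRealCLM.hasDerivAt (x := t)).const_mul (-lam))).cexp
      exact (h1.mul (hder t ht)).congr_deriv (by ring)
    intro t ht
    have := (convex_Iic (0 : ℝ)).is_const_of_fderivWithin_eq_zero (𝕜 := ℝ)
      (f := fun t : ℝ => Complex.exp (-lam * t) * Y t)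
      (fun t ht => (hd t ht).differentiableAt.differentiableWithinAt)
      (fun t ht => by
        have h3 := (hd t ht).hasFDerivAt.hasFDerivWithinAt (s := Iic 0)
        rw [h3.fderivWithin ((uniqueDiffOn_Iic 0) t ht)]
        ext; simp)
      (mem_Iic.mpr ht) (mem_Iic.mpr le_rfl)
    simpa using this
  -- Since `Re lam ≤ 0`, the solution does not decay towards `-∞`, against the limit zero found
  -- below.
  have hle : ∀ t : ℝ, t ≤ 0 → ‖Y 0‖ ≤ ‖Y t‖ := by
    intro t ht
    rw [← hconst t ht, norm_mul, Complex.norm_exp]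
    refine mul_le_of_le_one_left (norm_nonneg _) (Real.exp_le_one_iff.mpr ?_)
    simp only [neg_mul, Complex.neg_re, Complex.mul_re, Complex.ofReal_re, Complex.ofReal_im]
    nlinarith
  have hlim := (tendsto_integral_translate_smul_atBot hy hphi.continuous hc).norm
  rw [norm_zero] at hlim
  have h0 : ‖Y 0‖ ≤ 0 := ge_of_tendsto hlim
    ((Filter.eventually_le_atBot 0).mono fun t ht => hle t ht)
  simpa [hY] using h0

theorem ae_eq_zero_of_weak_ode_Ioi {lam : ℂ} (hlam : 0 ≤ lam.re) {y : ℝ → ℂ} (hy : MemLp y 2)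
    {a : ℝ} (h : ∀ phi : ℝ → ℝ, ContDiff ℝ ∞ phi → HasCompactSupport phi →
      tsupport phi ⊆ Ioi a → ∫ s, deriv phi s • y s = -lam * ∫ s, phi s • y s) :
    ∀ᵐ s, s ∈ Ioi a → y s = 0 := by
  have hneg := Measure.measurePreserving_neg (volume : Measure ℝ)
  have key := ae_eq_zero_of_weak_ode_Iio (lam := -lam) (by simpa using hlam) (y := fun s => y (-s))
    (a := -a) (hy.comp_measurePreserving hneg) (by
      intro phi hphi hc hsupp
      have hts : tsupport (fun s => phi (-s)) ⊆ Ioi a := by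
        intro s hs
        have h2 := hsupp (tsupport_comp_subset_preimage phi (f := fun s => -s) (by fun_prop) hs)
        rw [mem_Iio] at h2
        rw [mem_Ioi]
        linarith
      have h2 := h (fun s => phi (-s)) (hphi.comp contDiff_neg)
        (hc.comp_homeomorph (Homeomorph.neg ℝ)) hts
      rw [← integral_neg_eq_self, ← integral_neg_eq_self (fun s => phi (-s) • y s)] at h2
      simp only [deriv_comp_neg, neg_neg, neg_smul, integral_neg] at h2
      linear_combination -h2)
  have := hneg.quasiMeasurePreserving.ae key
  filter_upwards [this] with s hs h
  simpa using hs (by simpa using h)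

/-! ### Weak solutions of the operator equation on the whole line -/

section Evolution

variable {H : Type*} [NormedAddCommGroup H] [InnerProductSpace ℂ H]

/-- `w` is a weak solution on the real line of `w' + A w = lam w - delta_a f`. -/
def IsWeakSolution (A : H →ₗ.[ℂ] H) (lam : ℂ) (a : ℝ) (f : H) (w : ℝ → H) : Prop :=
  ∀ (phi : ℝ → ℝ) (g : A.domain), ContDiff ℝ ∞ phi → HasCompactSupport phi →
    lam * inner ℂ (g : H) (∫ s, phi s • w s) + inner ℂ (g : H) (∫ s, deriv phi s • w s) -
      inner ℂ (A g) (∫ s, phi s • w s) = (phi a : ℂ) * inner ℂ (g : H) f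

/-- Time reversal flips the sign of `d/dt`; multiplying the equation by `-1` moves the sign to the
other terms. It exchanges the two half-lines and the conditions `A ≤ 0` and `A ≥ 0`. -/
theorem IsWeakSolution.reflect {A : H →ₗ.[ℂ] H} {lam : ℂ} {a : ℝ} {f : H} {w : ℝ → H}
    (h : IsWeakSolution A lam a f w) :
    IsWeakSolution (-A) (-lam) (-a) (-f) (fun s => w (-s)) := by
  intro phi g hphi hc
  have h2 := h (fun s => phi (-s)) g (hphi.comp contDiff_neg)
    (hc.comp_homeomorph (Homeomorph.neg ℝ))
  rw [← integral_neg_eq_self, ← integral_neg_eq_self (fun s => deriv _ s • w s)] at h2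
  simp only [deriv_comp_neg, neg_neg, neg_smul, integral_neg, inner_neg_right] at h2
  rw [LinearPMap.neg_apply, inner_neg_left, inner_neg_right]
  linear_combination -h2

/-- An energy estimate run backwards from where `w` vanishes: dissipation makes the weighted energy
of each mollification nondecreasing, and it ends at zero. -/
theorem IsWeakSolution.ae_eq_zero [CompleteSpace H] {A : H →ₗ.[ℂ] H} (hA : IsSelfAdjoint A) (hneg : IsNonpos A)
    {lam : ℂ} {a : ℝ} {w : ℝ → H} (h : IsWeakSolution A lam a 0 w) (hw : LocallyIntegrable w)
    {b : ℝ} (hb : ∀ s, b ≤ s → w s = 0) : ∀ᵐ s, w s = 0 := by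
  refine ae_eq_zero_of_integral_contDiff_smul_eq_zero hw ?_
  intro phi hphi hc
  set U : ℝ → H := fun t => ∫ s, phi (s - t) • w s with hU
  set V : ℝ → H := fun t => -∫ s, deriv phi (s - t) • w s with hV
  have hder : ∀ t, HasDerivAt U (V t) t := hasDerivAt_integral_translate_smul hw hphi hc
  have heq : ∀ t, ∀ g : A.domain, inner ℂ (lam • U t - V t) (g : H) = inner ℂ (U t) (A g) := by
    intro t g
    have h2 := h (fun s => phi (s - t)) g (hphi.comp (contDiff_id.sub contDiff_const))
      (hc.comp_homeomorph (Homeomorph.subRight t))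
    simp only [deriv_comp_sub_const, inner_zero_right, mul_zero] at h2
    rw [← inner_conj_symm, ← inner_conj_symm (U t), inner_sub_right, inner_smul_right, hV,
      inner_neg_right]
    congr 1
    linear_combination h2
  -- The weak identity places `U t` in the domain of `A* = A` with `A (U t) = lam • U t - V t`; then
  -- `A ≤ 0` is applied to `U t` itself.
  have hmon : ∀ t, 2 * lam.re * ‖U t‖ ^ 2 ≤ 2 * (inner ℂ (U t) (V t)).re := by
    intro t
    have hd : U t ∈ A.adjoint.domain := LinearPMap.mem_adjoint_domain_of_exists _ ⟨_, heq t⟩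
    have hval : A.adjoint ⟨U t, hd⟩ = lam • U t - V t :=
      LinearPMap.adjoint_apply_eq hA.dense_domain ⟨U t, hd⟩ (heq t)
    have hg : (U t, lam • U t - V t) ∈ A.graph := by
      have h1 : (U t, lam • U t - V t) ∈ A.adjoint.graph := by
        rw [← hval]
        exact A.adjoint.mem_graph ⟨U t, hd⟩
      rwa [LinearPMap.isSelfAdjoint_def.mp hA] at h1
    rw [LinearPMap.mem_graph_iff] at hg
    obtain ⟨x, hx1, hx2⟩ := hg
    change (x : H) = U t at hx1
    change A x = _ at hx2
    have h1 := hneg x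
    have h2 : inner ℂ (U t) (U t) = ((‖U t‖ ^ 2 : ℝ) : ℂ) := by
      rw [inner_self_eq_norm_sq_to_K]; norm_cast
    rw [hx2, hx1, inner_sub_right, inner_smul_right, h2, Complex.sub_re, Complex.re_mul_ofReal] at h1
    linarith
  have hderN : ∀ t, HasDerivAt (fun t => Real.exp (-2 * lam.re * t) * ‖U t‖ ^ 2)
      (Real.exp (-2 * lam.re * t) * (-2 * lam.re) * ‖U t‖ ^ 2 +
        Real.exp (-2 * lam.re * t) * (2 * (inner ℂ (U t) (V t)).re)) t := by
    intro t
    let _ : InnerProductSpace ℝ H := InnerProductSpace.rclikeToReal ℂ H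
    have h1 : HasDerivAt (fun t => ‖U t‖ ^ 2) (2 * (inner ℂ (U t) (V t)).re) t := (hder t).norm_sq
    have h2 : HasDerivAt (fun t => Real.exp (-2 * lam.re * t))
        (Real.exp (-2 * lam.re * t) * (-2 * lam.re)) t := by
      simpa using ((hasDerivAt_id t).const_mul (-2 * lam.re)).exp
    exact h2.mul h1
  have hmono : Monotone (fun t => Real.exp (-2 * lam.re * t) * ‖U t‖ ^ 2) := by
    refine monotone_of_deriv_nonneg (fun t => (hderN t).differentiableAt) fun t => ?_
    rw [(hderN t).deriv]
    have := mul_le_mul_of_nonneg_left (hmon t) (Real.exp_pos (-2 * lam.re * t)).le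
    linarith
  obtain ⟨R, hR⟩ := hc.isCompact.isBounded.subset_closedBall 0
  have hzero : ∀ t, b + R < t → U t = 0 := by
    intro t ht
    refine integral_eq_zero_of_ae (Filter.Eventually.of_forall fun s => ?_)
    change phi (s - t) • w s = 0
    rcases le_or_gt b s with hs | hs
    · rw [hb s hs, smul_zero]
    · have : phi (s - t) = 0 := image_eq_zero_of_notMem_tsupport fun hmem => by
        have := hR hmem
        rw [mem_closedBall_zero_iff, Real.norm_eq_abs] at this
        linarith [neg_abs_le (s - t)]
      rw [this, zero_smul]
  have hfin := hmono (le_max_left 0 (b + R + 1))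
  simp only [hzero (max 0 (b + R + 1)) (by linarith [le_max_right 0 (b + R + 1)])] at hfin
  have h0 : ‖U 0‖ ^ 2 ≤ 0 := by simpa using hfin
  have h1 : U 0 = 0 := by
    rw [← norm_eq_zero]
    nlinarith [norm_nonneg (U 0)]
  simpa [hU] using h1

theorem inner_integral_smul [CompleteSpace H] {w : ℝ → H} (hw : LocallyIntegrable w)
    {phi : ℝ → ℝ} (h : Continuous phi) (hc : HasCompactSupport phi) (g : H) :
    inner ℂ g (∫ s, phi s • w s) = ∫ s, phi s • inner ℂ g (w s) := by
  rw [← integral_inner (hw.integrable_smul_left_of_hasCompactSupport h hc)]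
  refine integral_congr_ae (Filter.Eventually.of_forall fun s => ?_)
  exact inner_smul_right_eq_smul g (w s) (phi s)

/-- A square integrable weak solution on a left half-line has boundary value zero, if the boundary
value lies in the kernel of `A` and `Re lam ≤ 0`. -/
theorem IsWeakSolution.boundary_eq_zero_Iio [CompleteSpace H] {A : H →ₗ.[ℂ] H} {lam : ℂ}
    (hlam : lam.re ≤ 0) {a : ℝ} {f : H} {w : ℝ → H} (h : IsWeakSolution A lam a f w)
    (hf : (f, 0) ∈ A.graph) (hw : MemLp w 2) (hsupp : ∀ s, a ≤ s → w s = 0) : f = 0 := by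
  have hloc : LocallyIntegrable w := hw.locallyIntegrable (by norm_num)
  rw [LinearPMap.mem_graph_iff] at hf
  obtain ⟨g, hg1, hg2⟩ := hf
  change (g : H) = f at hg1
  change A g = 0 at hg2
  -- Testing with `g = f` removes the operator term because `A f = 0`.
  have heq : ∀ phi : ℝ → ℝ, ContDiff ℝ ∞ phi → HasCompactSupport phi →
      lam * (∫ s, phi s • inner ℂ f (w s)) + (∫ s, deriv phi s • inner ℂ f (w s)) =
        (phi a : ℂ) * inner ℂ f f := by
    intro phi hphi hc
    have h1 := h phi g hphi hc
    rw [hg2, inner_zero_left, sub_zero, hg1, inner_integral_smul hloc hphi.continuous hc,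
      inner_integral_smul hloc (hphi.continuous_deriv (by simp)) hc.deriv] at h1
    exact h1
  have hy : ∀ᵐ s, s ∈ Iio a → inner ℂ f (w s) = 0 := by
    refine ae_eq_zero_of_weak_ode_Iio hlam (hw.const_inner f) fun phi hphi hc hs => ?_
    have h1 := heq phi hphi hc
    have h2 : phi a = 0 := image_eq_zero_of_notMem_tsupport fun h => lt_irrefl a (hs h)
    rw [h2, Complex.ofReal_zero, zero_mul] at h1
    linear_combination h1
  have hy0 : ∀ᵐ s, inner ℂ f (w s) = 0 := by
    filter_upwards [hy] with s hs
    rcases lt_or_ge s a with h1 | h1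
    · exact hs h1
    · rw [hsupp s h1, inner_zero_right]
  have hint : ∀ phi : ℝ → ℝ, ∫ s, phi s • inner ℂ f (w s) = 0 := fun phi =>
    integral_eq_zero_of_ae (by filter_upwards [hy0] with s hs; simp [hs])
  -- Both integrals are now zero, so any test function equal to 1 at `a` leaves `(f, f) = 0`.
  let b : ContDiffBump a := ⟨1, 2, by norm_num, by norm_num⟩
  have h1 := heq b b.contDiff b.hasCompactSupport
  rw [hint, hint, b.one_of_mem_closedBall (Metric.mem_closedBall_self b.rIn_pos.le)] at h1
  refine (inner_self_eq_zero (𝕜 := ℂ)).mp ?_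
  simpa using h1.symm

theorem IsWeakSolution.boundary_eq_zero_Ioi [CompleteSpace H] {A : H →ₗ.[ℂ] H} {lam : ℂ}
    (hlam : 0 ≤ lam.re) {a : ℝ} {f : H} {w : ℝ → H} (h : IsWeakSolution A lam a f w)
    (hf : (f, 0) ∈ A.graph) (hw : MemLp w 2) (hsupp : ∀ s, s ≤ a → w s = 0) : f = 0 := by
  have hf' : (-f, (0 : H)) ∈ (-A).graph := by
    have h1 := A.graph.neg_mem hf
    rw [LinearPMap.mem_graph_iff] at h1 ⊢
    obtain ⟨g, hg1, hg2⟩ := h1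
    refine ⟨g, hg1, ?_⟩
    rw [LinearPMap.neg_apply, hg2]
    simp
  have := h.reflect.boundary_eq_zero_Iio (by simpa using hlam) hf'
    (hw.comp_measurePreserving (Measure.measurePreserving_neg volume))
    (fun s hs => hsupp _ (by linarith))
  exact neg_eq_zero.mp this

theorem IsWeakSolution.ae_eq_zero_Ioi [CompleteSpace H] {A : H →ₗ.[ℂ] H} (hA : IsSelfAdjoint A)
    (hpos : IsNonneg A) {lam : ℂ} {a : ℝ} {w : ℝ → H} (h : IsWeakSolution A lam a 0 w)
    (hw : MemLp w 2) (hsupp : ∀ s, s ≤ a → w s = 0) : ∀ᵐ s, w s = 0 := by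
  have hneg := Measure.measurePreserving_neg (volume : Measure ℝ)
  have h' := h.reflect
  rw [neg_zero] at h'
  have key := h'.ae_eq_zero (isSelfAdjoint_neg hA)
    (fun x => by
      rw [LinearPMap.neg_apply, inner_neg_right, Complex.neg_re]
      linarith [hpos x])
    ((hw.comp_measurePreserving hneg).locallyIntegrable (by norm_num)) (b := -a)
    (fun s hs => hsupp _ (by linarith))
  filter_upwards [hneg.quasiMeasurePreserving.ae key] with s hs
  simpa using hs

end Evolution

/-! ### Extension by zero from the half-line -/

section Restriction

variable {H : Type*} [NormedAddCommGroup H]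

theorem memLp_indicator_L2 {I : Set ℝ} (hI : MeasurableSet I) (u : L2 H I) :
    MemLp (I.indicator u) 2 :=
  (memLp_indicator_iff_restrict hI).mpr (Lp.memLp u)

theorem eq_zero_of_ae_indicator {I : Set ℝ} (hI : MeasurableSet I) (u : L2 H I)
    (h : ∀ᵐ s, s ∈ I → I.indicator u s = 0) : u = 0 := by
  refine Lp.eq_zero_iff_ae_eq_zero.mpr ((ae_restrict_iff' hI).mpr ?_)
  filter_upwards [h] with s hs hsI
  simpa [hsI] using hs hsI

end Restriction

/-! ### From test vector functions to weak equations -/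

section Differential

variable {H : Type*} [NormedAddCommGroup H] [InnerProductSpace ℂ H]

/-- A real-valued test function, regarded as a complex-valued one. -/
def TestFun.ofReal (phi : ℝ → ℝ) (h : ContDiff ℝ ∞ phi) (hc : HasCompactSupport phi) : TestFun :=
  ⟨fun t => (phi t : ℂ), Complex.ofRealCLM.contDiff.comp h,
    hc.comp_left (g := fun x : ℝ => (x : ℂ)) Complex.ofReal_zero⟩

theorem TestFun.derivative_ofReal (phi : ℝ → ℝ) (h : ContDiff ℝ ∞ phi) (hc : HasCompactSupport phi) :
    (TestFun.ofReal phi h hc).derivative =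
      TestFun.ofReal (deriv phi) (contDiff_infty_iff_deriv.mp h).2 hc.deriv := by
  refine Subtype.ext (funext fun t => ?_)
  exact ((h.differentiable (by simp) t).hasDerivAt.ofReal_comp).deriv

theorem TestFun.tsupport_ofReal_subset (phi : ℝ → ℝ) (h : ContDiff ℝ ∞ phi)
    (hc : HasCompactSupport phi) : tsupport (TestFun.ofReal phi h hc).1 ⊆ tsupport phi :=
  closure_mono (Function.support_comp_subset (g := fun x : ℝ => (x : ℂ)) Complex.ofReal_zero phi)

theorem inner_tensor_ofReal [CompleteSpace H] {I : Set ℝ} (hI : MeasurableSet I) {phi : ℝ → ℝ}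
    (h : ContDiff ℝ ∞ phi) (hc : HasCompactSupport phi) (g : H) (u : L2 H I) :
    inner ℂ (tensor I (TestFun.ofReal phi h hc) g) u =
      inner ℂ g (∫ s, phi s • I.indicator u s) := by
  have hloc : LocallyIntegrable (I.indicator u) :=
    (memLp_indicator_L2 hI u).locallyIntegrable (by norm_num)
  rw [inner_tensor_left, inner_integral_smul hloc h.continuous hc, ← integral_indicator hI]
  refine integral_congr_ae (Filter.Eventually.of_forall fun s => ?_)
  by_cases hs : s ∈ I
  · simp [hs, TestFun.ofReal]
  · simp [hs]

/-- Green's formula for test functions that need not vanish at `a` is precisely the equation of the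
zero extension, its boundary term being the point source. -/
theorem HasBoundaryValue.isWeakSolution [CompleteSpace H] {sigma : ℝ} {A : H →ₗ.[ℂ] H} {I : Set ℝ}
    (hI : MeasurableSet I) {a : ℝ} {u : L2 H I} {f : H} (h : HasBoundaryValue sigma A I a u f)
    {lam : ℂ} (hlam : ∀ hu : u ∈ (maximalOperator A I).domain,
      maximalOperator A I ⟨u, hu⟩ = lam • u) :
    IsWeakSolution A lam a ((sigma : ℂ) • f) (I.indicator u) := by
  obtain ⟨hu, h⟩ := h
  intro phi g hphi hc
  have h1 := h (TestFun.ofReal phi hphi hc) g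
  rw [hlam hu, TestFun.derivative_ofReal, inner_add_left, inner_neg_left, inner_smul_right,
    inner_tensor_ofReal hI, inner_tensor_ofReal hI, inner_tensor_ofReal hI, inner_smul_left] at h1
  have h2 : (starRingEnd ℂ) ((TestFun.ofReal phi hphi hc).1 a) = (phi a : ℂ) :=
    Complex.conj_ofReal _
  rw [h2] at h1
  rw [inner_smul_right]
  linear_combination h1

/-- Reduction to scalars: pairing with each `g` of a dense set gives a scalar equation. Uniqueness
for that equation is the hypothesis `hode`, so both half-lines are served. -/
theorem eq_zero_of_weak_ode [CompleteSpace H] {D : Set H} (hD : Dense D) {I : Set ℝ} (hI : IsOpen I)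
    {lam : ℂ}
    (hode : ∀ y : ℝ → ℂ, MemLp y 2 → (∀ phi : ℝ → ℝ, ContDiff ℝ ∞ phi → HasCompactSupport phi →
      tsupport phi ⊆ I → ∫ s, deriv phi s • y s = -lam * ∫ s, phi s • y s) →
      ∀ᵐ s, s ∈ I → y s = 0)
    (u : L2 H I) (hu : ∀ (phi : TestFun) (g : H), tsupport phi.1 ⊆ I → g ∈ D →
      inner ℂ (tensor I phi.derivative g) u = -lam * inner ℂ (tensor I phi g) u) : u = 0 := by
  have hmem := memLp_indicator_L2 hI.measurableSet u
  have hloc : LocallyIntegrable (I.indicator u) := hmem.locallyIntegrable (by norm_num)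
  refine eq_zero_of_ae_indicator hI.measurableSet u ?_
  refine hI.ae_eq_zero_of_integral_contDiff_smul_eq_zero (hloc.locallyIntegrableOn _) ?_
  intro phi hphi hc hs
  refine hD.eq_zero_of_inner_right ℂ fun g hg => ?_
  have hy := hode _ (hmem.const_inner g) fun psi hpsi hpc hps => by
    have h1 := hu (TestFun.ofReal psi hpsi hpc) g
      ((TestFun.tsupport_ofReal_subset psi hpsi hpc).trans hps) hg
    rw [TestFun.derivative_ofReal, inner_tensor_ofReal hI.measurableSet,
      inner_tensor_ofReal hI.measurableSet, inner_integral_smul hloc hpsi.continuous hpc,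
      inner_integral_smul hloc (hpsi.continuous_deriv (by simp)) hpc.deriv] at h1
    exact h1
  rw [inner_integral_smul hloc hphi.continuous hc]
  refine integral_eq_zero_of_ae ?_
  filter_upwards [hy] with s hs'
  by_cases h1 : s ∈ I
  · simp only [Pi.zero_apply, hs' h1, smul_zero]
  · simp [h1]

theorem tensor_mem_testGraph (s : ℝ) (A : H →ₗ.[ℂ] H) {I : Set ℝ} {phi : TestFun}
    (hphi : tsupport phi.1 ⊆ I) (g : A.domain) :
    (tensor I phi (g : H), (s : ℂ) • tensor I phi.derivative (g : H) + tensor I phi (A g)) ∈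
      testGraph s A I :=
  Submodule.subset_span ⟨phi, g, hphi, rfl⟩

end Differential

/-! ### Eigenvectors of normal operators, and orthogonal sums -/

section Operators

variable {E F : Type*}
variable [NormedAddCommGroup E] [InnerProductSpace ℂ E]
variable [NormedAddCommGroup F] [InnerProductSpace ℂ F]

theorem mem_graph_of_mem_kernel_posSqrt [CompleteSpace E] {T : E →ₗ.[ℂ] E} (hT : IsSelfAdjoint T)
    (hpos : IsNonneg T) {f : E} (hf : f ∈ kernel (posSqrt T)) : (f, 0) ∈ T.graph := by
  rw [(isPosSqrt_posSqrt hT hpos).sq]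
  obtain ⟨x, hx, rfl⟩ := hf
  refine ⟨0, ?_, Submodule.zero_mem _⟩
  have h1 : posSqrt T x = 0 := hx
  rw [← h1]
  exact (posSqrt T).mem_graph x

/-- An eigenvector of a normal operator is an eigenvector of its adjoint. -/
theorem IsNormal.adjoint_eigenvector [CompleteSpace E] {N : E →ₗ.[ℂ] E} (hN : IsNormal N)
    {lam : ℂ} {x : N.domain} (hx : N x = lam • (x : E)) (y : N.adjoint.domain)
    (hxy : (x : E) = y) : N.adjoint y = starRingEnd ℂ lam • (y : E) := by
  have hn := hN.norm_adjoint x y hxy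
  have hf := LinearPMap.adjoint_isFormalAdjoint hN.dense_domain y x
  rw [hx, hxy, inner_smul_right, inner_self_eq_norm_sq_to_K] at hf
  rw [hx, hxy, norm_smul] at hn
  -- In the expansion of `‖N* y - conj lam • y‖²` both squares and the cross term without its factor
  -- `-2` equal `‖lam‖² ‖y‖²`.
  rw [← sub_eq_zero, ← norm_eq_zero, ← sq_eq_zero_iff, @norm_sub_sq ℂ, ← hn, inner_smul_right, hf,
    norm_smul, RCLike.norm_conj]
  have h1 : starRingEnd ℂ lam * (lam * ((‖(y : E)‖ : ℝ) : ℂ) ^ 2) =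
      ((‖lam‖ ^ 2 * ‖(y : E)‖ ^ 2 : ℝ) : ℂ) := by
    rw [← mul_assoc, Complex.conj_mul']
    push_cast
    ring
  have h2 : RCLike.re (starRingEnd ℂ lam * (lam * ((‖(y : E)‖ : ℝ) : ℂ) ^ 2)) =
      ‖lam‖ ^ 2 * ‖(y : E)‖ ^ 2 := by
    rw [h1]
    exact Complex.ofReal_re _
  change _ - 2 * RCLike.re (starRingEnd ℂ lam * (lam * ((‖(y : E)‖ : ℝ) : ℂ) ^ 2)) + _ = _
  rw [h2]
  ring

/-- If `S ≤ N` with `N` normal and `S, S'` are formally adjoint, then an eigenvector `x` of `N` is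
also a generalized eigenvector of `S' - S`. -/
theorem IsNormal.inner_sub_eigenvector [CompleteSpace E] {N S S' : E →ₗ.[ℂ] E} (hN : IsNormal N)
    (hS : S ≤ N) (hdense : Dense (S.domain : Set E)) (hSS' : S.IsFormalAdjoint S')
    {lam : ℂ} {x : N.domain} (hx : N x = lam • (x : E)) {z b b' : E} (hb : (z, b) ∈ S.graph)
    (hb' : (z, b') ∈ S'.graph) :
    inner ℂ (b - b') (x : E) = (starRingEnd ℂ lam - lam) * inner ℂ z (x : E) := by
  rw [LinearPMap.mem_graph_iff] at hb hb'
  obtain ⟨s, hs1, hs2⟩ := hb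
  obtain ⟨s', hs1', hs2'⟩ := hb'
  change (s : E) = z at hs1
  change S s = b at hs2
  change (s' : E) = z at hs1'
  change S' s' = b' at hs2'
  have hadj := LinearPMap.adjoint_isFormalAdjoint hN.dense_domain
  have hzN : z ∈ N.domain := hs1 ▸ hS.1 s.2
  have hzA : z ∈ N.adjoint.domain := by rw [hN.domain_adjoint]; exact hzN
  have hxA : (x : E) ∈ N.adjoint.domain := by rw [hN.domain_adjoint]; exact x.2
  have hNz : N ⟨z, hzN⟩ = b := by rw [← hs2]; exact (hS.2 hs1).symm
  -- Normality puts `z` into the domain of `N*`; the value is then determined by pairing with the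
  -- dense domain of `S`.
  have hAz : N.adjoint ⟨z, hzA⟩ = b' := by
    refine hdense.eq_of_inner_left ℂ fun v hv => ?_
    have h1 := hadj ⟨z, hzA⟩ ⟨v, hS.1 hv⟩
    have h2 : N ⟨v, hS.1 hv⟩ = S ⟨v, hv⟩ := (hS.2 rfl).symm
    rw [h2] at h1
    have h3 := hSS'.symm s' ⟨v, hv⟩
    rw [hs2', hs1'] at h3
    exact h1.trans h3.symm
  have e1 := hadj ⟨z, hzA⟩ x
  rw [hAz, hx, inner_smul_right] at e1
  have e2 := hadj.symm ⟨z, hzN⟩ ⟨x, hxA⟩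
  rw [hNz, hN.adjoint_eigenvector hx ⟨x, hxA⟩ rfl, inner_smul_right] at e2
  rw [inner_sub_left, e1, e2]
  ring

theorem mem_graph_dirSum {S : E →ₗ.[ℂ] E} {T : F →ₗ.[ℂ] F} {x y : E} {x' y' : F}
    (h : (x, y) ∈ S.graph) (h' : (x', y') ∈ T.graph) :
    (WithLp.toLp 2 (x, x'), WithLp.toLp 2 (y, y')) ∈ (dirSum S T).graph := by
  rw [LinearPMap.mem_graph_iff] at h h'
  obtain ⟨s, rfl, rfl⟩ := h
  obtain ⟨t, rfl, rfl⟩ := h'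
  exact (dirSum S T).mem_graph ⟨WithLp.toLp 2 ((s : E), (t : F)), s.2, t.2⟩

theorem dirSum_mono {S S' : E →ₗ.[ℂ] E} {T T' : F →ₗ.[ℂ] F} (hS : S ≤ S') (hT : T ≤ T') :
    dirSum S T ≤ dirSum S' T' := by
  refine ⟨fun u hu => ⟨hS.1 hu.1, hT.1 hu.2⟩, fun x y hxy => ?_⟩
  obtain ⟨x, hx⟩ := x
  obtain ⟨y, hy⟩ := y
  obtain rfl : x = y := hxy
  have h1 : S ⟨x.fst, hx.1⟩ = S' ⟨x.fst, hy.1⟩ := hS.2 rfl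
  have h2 : T ⟨x.snd, hx.2⟩ = T' ⟨x.snd, hy.2⟩ := hT.2 rfl
  change WithLp.toLp 2 (S ⟨x.fst, hx.1⟩, T ⟨x.snd, hx.2⟩) = WithLp.toLp 2 (_, _)
  rw [h1, h2]

theorem dirSum_isFormalAdjoint {S S' : E →ₗ.[ℂ] E} {T T' : F →ₗ.[ℂ] F} (hS : S.IsFormalAdjoint S')
    (hT : T.IsFormalAdjoint T') : (dirSum S T).IsFormalAdjoint (dirSum S' T') := by
  intro x y
  rw [WithLp.prod_inner_apply, WithLp.prod_inner_apply]
  exact congrArg₂ (· + ·) (hS ⟨_, x.2.1⟩ ⟨_, y.2.1⟩) (hT ⟨_, x.2.2⟩ ⟨_, y.2.2⟩)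

theorem dense_domain_dirSum {S : E →ₗ.[ℂ] E} {T : F →ₗ.[ℂ] F} (hS : Dense (S.domain : Set E))
    (hT : Dense (T.domain : Set F)) :
    Dense ((dirSum S T).domain : Set (WithLp 2 (E × F))) :=
  (hS.prod hT).preimage (WithLp.homeomorphProd 2 E F).isOpenMap

end Operators

/-! ### The two point spectra -/

section Main

variable {H : Type*} [NormedAddCommGroup H] [InnerProductSpace ℂ H]


/-- The difference of `d/dt + A` and `-d/dt + A` is `2 d/dt`, and `conj lam - lam = -2i Im lam`:
only a scalar equation with imaginary exponent remains. -/
theorem inner_tensor_derivative_of_inner_sub {A : H →ₗ.[ℂ] H} {I : Set ℝ} {u : L2 H I} {lam : ℂ}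
    (h : ∀ b b' z, (z, b) ∈ testGraph 1 A I → (z, b') ∈ testGraph (-1) A I →
      inner ℂ (b - b') u = (starRingEnd ℂ lam - lam) * inner ℂ z u)
    (phi : TestFun) (g : H) (hphi : tsupport phi.1 ⊆ I) (hg : g ∈ (A.domain : Set H)) :
    inner ℂ (tensor I phi.derivative g) u =
      -(lam.im * Complex.I) * inner ℂ (tensor I phi g) u := by
  have h1 := h _ _ _ (tensor_mem_testGraph 1 A hphi ⟨g, hg⟩) (tensor_mem_testGraph (-1) A hphi ⟨g, hg⟩)
  have h2 : starRingEnd ℂ lam - lam = -(2 * lam.im * Complex.I) := by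
    apply Complex.ext
    · simp
    · simp
      ring
  rw [h2] at h1
  simp only [inner_sub_left, inner_add_left, inner_smul_left, map_neg, map_one,
    Complex.ofReal_neg, Complex.ofReal_one] at h1
  linear_combination h1 / 2

theorem pointSpectrum_normalExtension [CompleteSpace H] {A₁ A₃ : H →ₗ.[ℂ] H} (hA₁ : IsSelfAdjoint A₁)
    (hA₃ : IsSelfAdjoint A₃) {a₁ a₃ : ℝ}
    {N : WithLp 2 (L2 H (Iio a₁) × L2 H (Ioi a₃)) →ₗ.[ℂ] WithLp 2 (L2 H (Iio a₁) × L2 H (Ioi a₃))}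
    (hN : IsNormalExtension (minimalOperatorSum A₁ A₃ a₁ a₃) N) : pointSpectrum N = ∅ := by
  rw [Set.eq_empty_iff_forall_notMem]
  rintro lam ⟨x, hx0, hx⟩
  obtain ⟨hle, hN⟩ := hN
  have hS : dirSum (testOperator 1 A₁ (Iio a₁)) (testOperator 1 A₃ (Ioi a₃)) ≤ N :=
    (dirSum_mono (testOperator 1 A₁ (Iio a₁)).le_closure
      (testOperator 1 A₃ (Ioi a₃)).le_closure).trans hle
  have key := fun z b b' => hN.inner_sub_eigenvector hS
    (dense_domain_dirSum (dense_testGraph 1 hA₁.dense_domain isOpen_Iio)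
      (dense_testGraph 1 hA₃.dense_domain isOpen_Ioi))
    (dirSum_isFormalAdjoint (testOperator_isFormalAdjoint 1 hA₁ isOpen_Iio)
      (testOperator_isFormalAdjoint 1 hA₃ isOpen_Ioi)) hx (z := z) (b := b) (b' := b')
  -- Real part zero meets the sign conditions on both half-lines.
  have hre : (lam.im * Complex.I : ℂ).re = 0 := by simp
  have h1 : (x : WithLp 2 (L2 H (Iio a₁) × L2 H (Ioi a₃))).fst = 0 := by
    refine eq_zero_of_weak_ode hA₁.dense_domain isOpen_Iio
      (fun y hy => ae_eq_zero_of_weak_ode_Iio hre.le hy) _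
      (inner_tensor_derivative_of_inner_sub fun b b' z hb hb' => ?_)
    rw [← testOperator_graph _ hA₁ isOpen_Iio] at hb hb'
    have h := key _ _ _ (mem_graph_dirSum hb (Submodule.zero_mem _))
      (mem_graph_dirSum hb' (Submodule.zero_mem _))
    simpa [WithLp.prod_inner_apply, inner_sub_left] using h
  have h3 : (x : WithLp 2 (L2 H (Iio a₁) × L2 H (Ioi a₃))).snd = 0 := by
    refine eq_zero_of_weak_ode hA₃.dense_domain isOpen_Ioi
      (fun y hy => ae_eq_zero_of_weak_ode_Ioi hre.ge hy) _
      (inner_tensor_derivative_of_inner_sub fun b b' z hb hb' => ?_)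
    rw [← testOperator_graph _ hA₃ isOpen_Ioi] at hb hb'
    have h := key _ _ _ (mem_graph_dirSum (Submodule.zero_mem _) hb)
      (mem_graph_dirSum (Submodule.zero_mem _) hb')
    simpa [WithLp.prod_inner_apply, inner_sub_left] using h
  exact hx0 (WithLp.ofLp_injective 2 (Prod.ext h1 h3))

theorem pointSpectrum_boundaryOperator [CompleteSpace H] {A₁ A₃ : H →ₗ.[ℂ] H} (hA₁ : IsSelfAdjoint A₁)
    (hneg : IsNonpos A₁) (hA₃ : IsSelfAdjoint A₃) (hpos : IsNonneg A₃) (a₁ a₃ : ℝ)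
    (W : H ≃ₗᵢ[ℂ] H) : pointSpectrum (boundaryOperator A₁ A₃ a₁ a₃ W) = ∅ := by
  rw [Set.eq_empty_iff_forall_notMem]
  rintro lam ⟨⟨u, hu⟩, hu0, hx⟩
  obtain ⟨f₁, f₃, hb₁, hb₃, hW, hk₁, hk₃⟩ := hu.1
  have hx' : maximalOperatorSum A₁ A₃ a₁ a₃ ⟨u, hu.2⟩ = lam • u := hx
  have w₁ := hb₁.isWeakSolution measurableSet_Iio fun _ => congrArg WithLp.fst hx'
  have w₃ := hb₃.isWeakSolution measurableSet_Ioi fun _ => congrArg WithLp.snd hx'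
  have g₁ : (f₁, (0 : H)) ∈ A₁.graph := by
    have h := mem_graph_of_mem_kernel_posSqrt (isSelfAdjoint_neg hA₁) (isNonneg_neg hneg) hk₁
    rw [LinearPMap.mem_graph_iff] at h ⊢
    obtain ⟨g, hg1, hg2⟩ := h
    refine ⟨g, hg1, ?_⟩
    rw [LinearPMap.neg_apply] at hg2
    exact neg_eq_zero.mp hg2
  have g₃ := mem_graph_of_mem_kernel_posSqrt hA₃ hpos hk₃
  have m₁ := memLp_indicator_L2 measurableSet_Iio u.fst
  have m₃ := memLp_indicator_L2 measurableSet_Ioi u.snd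
  have z₁ : ∀ s, a₁ ≤ s → (Iio a₁).indicator u.fst s = 0 := fun s hs =>
    indicator_of_notMem (notMem_Iio.mpr hs) _
  have z₃ : ∀ s, s ≤ a₃ → (Ioi a₃).indicator u.snd s = 0 := fun s hs =>
    indicator_of_notMem (notMem_Ioi.mpr hs) _
  rw [Complex.ofReal_one, one_smul] at w₁
  rw [Complex.ofReal_neg, Complex.ofReal_one, neg_smul, one_smul] at w₃
  -- The sign of `Re lam` decides which half-line kills its boundary value; the unitary `W`
  -- transfers this to the other.
  have hf₁ : f₁ = 0 := by
    rcases le_total lam.re 0 with hlam | hlam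
    · exact w₁.boundary_eq_zero_Iio hlam g₁ m₁ z₁
    · have h := w₃.boundary_eq_zero_Ioi hlam (by simpa using A₃.graph.neg_mem g₃) m₃ z₃
      rw [neg_eq_zero, hW] at h
      simpa using h
  have hf₃ : f₃ = 0 := by rw [hW, hf₁, map_zero]
  rw [hf₁] at w₁
  rw [hf₃, neg_zero] at w₃
  have h1 : u.fst = 0 := eq_zero_of_ae_indicator measurableSet_Iio _
    ((w₁.ae_eq_zero hA₁ hneg (m₁.locallyIntegrable (by norm_num)) z₁).mono fun _ h _ => h)
  have h3 : u.snd = 0 := eq_zero_of_ae_indicator measurableSet_Ioi _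
    ((w₃.ae_eq_zero_Ioi hA₃ hpos m₃ z₃).mono fun _ h _ => h)
  exact hu0 (WithLp.ofLp_injective 2 (Prod.ext h1 h3))

end Main

end NormalExtension

end

theorem theorem3p1 {H : Type*} [NormedAddCommGroup H] [InnerProductSpace ℂ H] [CompleteSpace H]
    [TopologicalSpace.SeparableSpace H]
    (A₁ A₃ : H →ₗ.[ℂ] H)
    (hA₁ : IsSelfAdjoint A₁) (hA₁_nonpos : NormalExtension.IsNonpos A₁)
    (hA₃ : IsSelfAdjoint A₃) (hA₃_nonneg : NormalExtension.IsNonneg A₃)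
    (a₁ a₃ : ℝ) (ha : a₁ < a₃)
    (h₁ : (0 : ℂ) ∈ NormalExtension.pointSpectrum (NormalExtension.posSqrt (-A₁)))
    (h₃ : (0 : ℂ) ∈ NormalExtension.pointSpectrum (NormalExtension.posSqrt A₃)) :
    (∀ N : WithLp 2 (NormalExtension.L2 H (Set.Iio a₁) × NormalExtension.L2 H (Set.Ioi a₃)) →ₗ.[ℂ]
        WithLp 2 (NormalExtension.L2 H (Set.Iio a₁) × NormalExtension.L2 H (Set.Ioi a₃)),
      NormalExtension.IsNormalExtension (NormalExtension.minimalOperatorSum A₁ A₃ a₁ a₃) N →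
        NormalExtension.pointSpectrum N = ∅) ∧
    (∀ W : H ≃ₗᵢ[ℂ] H,
      NormalExtension.pointSpectrum (NormalExtension.boundaryOperator A₁ A₃ a₁ a₃ W) = ∅) := by
  exact ⟨fun N hN => NormalExtension.pointSpectrum_normalExtension hA₁ hA₃ hN,
    fun W => NormalExtension.pointSpectrum_boundaryOperator hA₁ hA₁_nonpos hA₃ hA₃_nonneg a₁ a₃ W⟩
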